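/- **Theorem (classical HAC estimation with nonparametric parameter estimates).** *Setting.* Let $\Theta\subset\mathbb{R}^d$ be a parameter set, convex near $\beta_0\in\Theta$ (i.e. $\Theta\cap B(\beta_0,r)$ is convex for some $r>0$) and such that derivatives relative to $\Theta$ are uniquely determined (for instance a convex set with non-empty interior, or an open set). For each $t\in\mathbb{Z}$ and $\beta\in\Theta$ let $V_t(\beta)$ be a random vector in $\mathbb{R}^p$; write $V_t=V_t(\beta_0)$, $\Gamma(k)=\mathbb{E}(V_tV_{t-k}')$, and let $\kappa^{(a,b,c,d)}_{V,0}(k,s,l)$ be the fourth-order cumulant of $(V^{(a)}_0,V^{(b)}_k,V^{(c)}_s,V^{(d)}_l)$. Let $\widehat\beta_{np}=\widehat\beta_{np,T}\in\Theta$ be estimators, $\widehat V_t=V_t(\widehat\beta_{np})$, and $$J_T=\frac1T\sum_{s=1}^T\sum_{t=1}^T\mathbb{E}(V_sV_t'),\qquad \widehat J_{\mathrm{Cla},T}(b)=\frac{T}{T-p}\sum_{k=-T+1}^{T-1}K_1(bk)\,\widehat\Gamma_{\mathrm{Cla}}(k),$$ where $\widehat\Gamma_{\mathrm{Cla}}(k)=T^{-1}\sum_{t=k+1}^T\widehat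 V_t\widehat V_{t-k}'$ for $k\ge0$ and $\widehat\Gamma_{\mathrm{Cla}}(k)=T^{-1}\sum_{t=-k+1}^T\widehat V_{t+k}\widehat V_t'$ for $k<0$. *Assumptions.* (K) $K_1:\mathbb{R}\to[-1,1]$ is even, $K_1(0)=1$, $\int K_1^2<\infty$, $K_1$ is continuous at $0$ and at all but finitely many points; $q\in(0,\infty)$ is such that $K_{1,q}=\lim_{x\downarrow0}(1-K_1(x))/|x|^q$ exists in $(0,\infty)$; $|K_1(y)|\le C_1|y|^{-b}$ for all $y\neq0$, for some $b>1+1/q$ and $C_1<\infty$; and $|K_1(x)-K_1(y)|\le C_2|x-y|$ for all $x,y$ and some $C_2<\infty$. (A) $\{V_t\}$ is a mean-zero, fourth-order stationary sequence with $\sum_{k\in\mathbb{Z}}\|\Gamma(k)\|<\infty$ and $\sum_{k,s,l\in\mathbb{Z}}|\kappa^{(a,b,c,d)}_{V,0}(k,s,l)|<\infty$ for all $a,b,c,d\le p$. (B) For some $\vartheta\in(0,1/2)$, $T^\vartheta(\widehat\beta_{np}-\beta_0)=O_{\mathbb{P}}(1)$; $\sup_{t\ge1}\mathbb{E}\|V_t\|^2<\infty$;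 $V_t(\cdot)$ is almost surely differentiable on $\Theta$ and $\sup_{t\ge1}\mathbb{E}\sup_{\beta\in\Theta}\|\tfrac{\partial}{\partial\beta}V_t(\beta)\|^2<\infty$; $\int|K_1(y)|\,dy<\infty$. (C) Assumption (A) also holds for the sequence $\bigl(V_t',\ \mathrm{vec}\bigl(\tfrac{\partial}{\partial\beta'}V_t(\beta_0)-\mathbb{E}\tfrac{\partial}{\partial\beta'}V_t(\beta_0)\bigr)'\bigr)'$; $V_t(\cdot)$ is almost surely twice differentiable on $\Theta$ and $\sup_{t\ge1}\mathbb{E}\sup_{\beta\in\Theta}\|\tfrac{\partial^2}{\partial\beta\partial\beta'}V^{(a)}_t(\beta)\|^2<\infty$ for $a=1,\dots,p$. (E) $\widehat\alpha(q)=\widehat\alpha_T(q)$ is any sequence of random variables with $\widehat\alpha(q)=O_{\mathbb{P}}(1)$ and $1/\widehat\alpha(q)=O_{\mathbb{P}}(1)$, where $1/\widehat\alpha(q)$ counts as $+\infty$ when $\widehat\alpha(q)\le0$; its form depends on the approximating parametric model. The data-dependent bandwidth is $$\widehat b_{\mathrm{Cla},1,T}=\Bigl(q\,K_{1,q}^2\,\widehat\alpha(q)\,T\Big/\int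 K_1^2(x)\,dx\Bigr)^{-1/(2q+1)}.$$ (F) The series $f^{(q)}=(2\pi)^{-1}\sum_{k\in\mathbb{Z}}|k|^q\,\Gamma(k)$ converges (that is, $\|f^{(q)}\|<\infty$). *Conclusion.* If $q>(1/\vartheta-1)/2$, then $\widehat J_{\mathrm{Cla},T}(\widehat b_{\mathrm{Cla},1,T})-J_T\xrightarrow{\ \mathbb{P}\ }0$ as $T\to\infty$. -/

import Mathlib

open MeasureTheory Filter Topology
open scoped ENNReal NNReal Matrix.Norms.Frobenius

noncomputable section

namespace HAC

/-- `X_T = O_P(1)` for a sequence of `[0, ∞]`-valued magnitudes: for every `ε > 0` there is a finite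
`M` with `P (X_T > M) ≤ ε` for all large `T`. -/
def BoundedInProb {Ω : Type*} [MeasurableSpace Ω] (P : Measure Ω) (X : ℕ → Ω → ℝ≥0∞) : Prop :=
  ∀ ε : ℝ≥0∞, 0 < ε → ∃ M : ℝ≥0, ∀ᶠ T in atTop, P {ω | (M : ℝ≥0∞) < X T ω} ≤ ε

/-! ### Kernels -/

/-- The kernel class `K₁`. -/
structure KernelClass1 (K : ℝ → ℝ) : Prop where
  mem_Icc : ∀ x, K x ∈ Set.Icc (-1 : ℝ) 1
  at_zero : K 0 = 1
  even : ∀ x, K x = K (-x)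
  sq_integrable : Integrable (fun x => K x ^ 2)
  continuousAt_zero : ContinuousAt K 0
  finite_discontinuities : {x | ¬ ContinuousAt K x}.Finite

/-- `K_{1,q} = lim_{x ↓ 0} (1 - K(x)) / |x|^q`. -/
def parzenCoeff (K : ℝ → ℝ) (q : ℝ) : ℝ :=
  limUnder (𝓝[>] (0 : ℝ)) (fun x => (1 - K x) / |x| ^ q)

/-- The kernel class `K_{3,Cla}`, with the exponent `q` made explicit. The condition
`parzen_pos` says that the limit `K_{1,q}` exists and lies in `(0, ∞)`. -/
structure KernelClass3 (K : ℝ → ℝ) (q : ℝ) : Prop extends KernelClass1 K where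
  q_pos : 0 < q
  parzen_pos : ∃ c : ℝ, 0 < c ∧ Tendsto (fun x => (1 - K x) / |x| ^ q) (𝓝[>] (0 : ℝ)) (𝓝 c)
  decay : ∃ b : ℝ, 1 + 1 / q < b ∧ ∃ C₁ : ℝ, ∀ y : ℝ, y ≠ 0 → |K y| ≤ C₁ * |y| ^ (-b)
  lipschitz : ∃ C₂ : ℝ, ∀ x y : ℝ, |K x - K y| ≤ C₂ * |x - y|

/-! ### Second and fourth order structure of a process -/

section Moments

variable {Ω : Type*} [MeasurableSpace Ω] {ι : Type*}

/-- The autocovariance matrix `Γ(k) = E (X_0 X_{-k}')` of a mean-zero stationary process. -/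
def autocov (P : Measure Ω) (X : ℤ → Ω → ι → ℝ) (k : ℤ) : Matrix ι ι ℝ :=
  Matrix.of fun a b => ∫ ω, X 0 ω a * X (-k) ω b ∂P

/-- The fourth order cumulant `κ_{X,0}^{(a,b,c,d)}(k,s,l)` of `X_0^{(a)}, X_k^{(b)}, X_s^{(c)},
X_l^{(d)}` for a mean-zero process: the fourth moment minus the fourth moment of a Gaussian
sequence with the same mean (zero) and covariances. -/
def cumulant4 (P : Measure Ω) (X : ℤ → Ω → ι → ℝ) (a b c d : ι) (k s l : ℤ) : ℝ :=
  (∫ ω, X 0 ω a * X k ω b * X s ω c * X l ω d ∂P)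
    - ((∫ ω, X 0 ω a * X k ω b ∂P) * (∫ ω, X s ω c * X l ω d ∂P)
      + (∫ ω, X 0 ω a * X s ω c ∂P) * (∫ ω, X k ω b * X l ω d ∂P)
      + (∫ ω, X 0 ω a * X l ω d ∂P) * (∫ ω, X k ω b * X s ω c ∂P))

/-- Fourth order stationarity: fourth moments are finite and all joint moments of order at most
four are invariant under time shifts. -/
structure FourthOrderStationary (P : Measure Ω) (X : ℤ → Ω → ι → ℝ) : Prop where
  memLp : ∀ t a, MemLp (fun ω => X t ω a) 4 P
  shift : ∀ n : ℕ, n ≤ 4 → ∀ (τ : Fin n → ℤ) (a : Fin n → ι) (h : ℤ),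
    ∫ ω, ∏ i, X (τ i + h) ω (a i) ∂P = ∫ ω, ∏ i, X (τ i) ω (a i) ∂P

/-- Dependence condition: a mean-zero fourth order stationary process with absolutely summable
autocovariances and fourth order cumulants. -/
structure DependenceCondition [Fintype ι] (P : Measure Ω) (X : ℤ → Ω → ι → ℝ) : Prop where
  mean_zero : ∀ t a, ∫ ω, X t ω a ∂P = 0
  stationary : FourthOrderStationary P X
  summable_autocov : Summable fun k : ℤ => ‖autocov P X k‖
  summable_cumulant : ∀ a b c d : ι,
    Summable fun m : ℤ × ℤ × ℤ => |cumulant4 P X a b c d m.1 m.2.1 m.2.2|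

/-- `‖f^{(q)}‖ < ∞`, where `f^{(q)} = (2π)⁻¹ ∑_{k ∈ ℤ} |k|^q Γ(k)`: the partial sums over
`|k| ≤ N` converge to a (finite) matrix. -/
def SpectralDerivFinite (P : Measure Ω) (X : ℤ → Ω → ι → ℝ) (q : ℝ) : Prop :=
  ∃ F : Matrix ι ι ℝ, Tendsto
    (fun N : ℕ => (2 * Real.pi)⁻¹ •
      ∑ k ∈ Finset.Icc (-(N : ℤ)) N, |(k : ℝ)| ^ q • autocov P X k) atTop (𝓝 F)

end Moments

/-! ### The model `V_t(β)`, `β ∈ Θ ⊆ ℝ^d`, with values in `ℝ^p` -/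

section Model

variable {Ω : Type*} [MeasurableSpace Ω] {p d : ℕ}

/-- Coordinates of the process `V_t = V_t(β₀)`. -/
def trueProcess (V : ℤ → EuclideanSpace ℝ (Fin d) → Ω → EuclideanSpace ℝ (Fin p))
    (β₀ : EuclideanSpace ℝ (Fin d)) : ℤ → Ω → Fin p → ℝ :=
  fun t ω a => V t β₀ ω a

/-- The Jacobian entry `∂V_t^{(a)}/∂β^{(j)}` at `β`, derivatives being taken relative to `Θ`. -/
def jacobianEntry (V : ℤ → EuclideanSpace ℝ (Fin d) → Ω → EuclideanSpace ℝ (Fin p))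
    (Θ : Set (EuclideanSpace ℝ (Fin d))) (β : EuclideanSpace ℝ (Fin d))
    (t : ℤ) (ω : Ω) (a : Fin p) (j : Fin d) : ℝ :=
  fderivWithin ℝ (fun β => V t β ω) Θ β (EuclideanSpace.single j 1) a

/-- The stacked process `(V_t', vec(∂V_t(β₀)/∂β' - E ∂V_t(β₀)/∂β')')'`. -/
def augmentedProcess (P : Measure Ω)
    (V : ℤ → EuclideanSpace ℝ (Fin d) → Ω → EuclideanSpace ℝ (Fin p))
    (Θ : Set (EuclideanSpace ℝ (Fin d))) (β₀ : EuclideanSpace ℝ (Fin d)) :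
    ℤ → Ω → (Fin p ⊕ Fin p × Fin d) → ℝ :=
  fun t ω => Sum.elim (fun a => V t β₀ ω a)
    (fun aj => jacobianEntry V Θ β₀ t ω aj.1 aj.2
      - ∫ ω', jacobianEntry V Θ β₀ t ω' aj.1 aj.2 ∂P)

/-- Rate of the parameter estimate, moment conditions, differentiability of `β ↦ V_t(β)` on `Θ`,
and integrability of the kernel. -/
structure EstimationCondition (P : Measure Ω)
    (V : ℤ → EuclideanSpace ℝ (Fin d) → Ω → EuclideanSpace ℝ (Fin p))
    (Θ : Set (EuclideanSpace ℝ (Fin d))) (β₀ : EuclideanSpace ℝ (Fin d))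
    (βhat : ℕ → Ω → EuclideanSpace ℝ (Fin d)) (ϑ : ℝ) (K : ℝ → ℝ) : Prop where
  rate : BoundedInProb P fun T ω => ‖(T : ℝ) ^ ϑ • (βhat T ω - β₀)‖ₑ
  moment : (⨆ (t : ℤ) (_ : 1 ≤ t), ∫⁻ ω, ‖V t β₀ ω‖ₑ ^ 2 ∂P) < ∞
  differentiable : ∀ᵐ ω ∂P, ∀ t : ℤ, 1 ≤ t → DifferentiableOn ℝ (fun β => V t β ω) Θ
  deriv_measurable : ∀ t : ℤ, 1 ≤ t →
    AEMeasurable (fun ω => ⨆ β ∈ Θ, ‖fderivWithin ℝ (fun β => V t β ω) Θ β‖ₑ ^ 2) P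
  deriv_moment : (⨆ (t : ℤ) (_ : 1 ≤ t),
    ∫⁻ ω, ⨆ β ∈ Θ, ‖fderivWithin ℝ (fun β => V t β ω) Θ β‖ₑ ^ 2 ∂P) < ∞
  kernel_integrable : Integrable K

/-- Dependence condition for the process stacked with its Jacobian at `β₀`, and second moments of
the second derivatives of the components of `V_t`. -/
structure DerivativeCondition (P : Measure Ω)
    (V : ℤ → EuclideanSpace ℝ (Fin d) → Ω → EuclideanSpace ℝ (Fin p))
    (Θ : Set (EuclideanSpace ℝ (Fin d))) (β₀ : EuclideanSpace ℝ (Fin d)) : Prop where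
  differentiable_at : ∀ᵐ ω ∂P, ∀ t : ℤ, DifferentiableWithinAt ℝ (fun β => V t β ω) Θ β₀
  dependence : DependenceCondition P (augmentedProcess P V Θ β₀)
  twice_differentiable : ∀ᵐ ω ∂P, ∀ t : ℤ, 1 ≤ t →
    DifferentiableOn ℝ (fun β => V t β ω) Θ ∧
      DifferentiableOn ℝ (fderivWithin ℝ (fun β => V t β ω) Θ) Θ
  deriv2_measurable : ∀ a : Fin p, ∀ t : ℤ, 1 ≤ t →
    AEMeasurable (fun ω => ⨆ β ∈ Θ,
      ‖fderivWithin ℝ (fderivWithin ℝ (fun β => V t β ω a) Θ) Θ β‖ₑ ^ 2) P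
  deriv2_moment : ∀ a : Fin p, (⨆ (t : ℤ) (_ : 1 ≤ t), ∫⁻ ω, ⨆ β ∈ Θ,
    ‖fderivWithin ℝ (fderivWithin ℝ (fun β => V t β ω a) Θ) Θ β‖ₑ ^ 2 ∂P) < ∞

/-- `αhat = O_P(1)` and `1 / αhat = O_P(1)`, where `1 / αhat` counts as infinite when
`αhat ≤ 0`. -/
structure PlugInCondition (P : Measure Ω) (αhat : ℕ → Ω → ℝ) : Prop where
  bounded : BoundedInProb P fun T ω => ‖αhat T ω‖ₑ
  inv_bounded : BoundedInProb P fun T ω => (ENNReal.ofReal (αhat T ω))⁻¹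

/-! ### The estimator and its target -/

/-- The outer product `x y'`. -/
def outer (x y : EuclideanSpace ℝ (Fin p)) : Matrix (Fin p) (Fin p) ℝ :=
  Matrix.of fun a b => x a * y b

/-- Sample autocovariance at lag `k` of the data `v_1, …, v_T`. -/
def sampleAutocov (v : ℤ → EuclideanSpace ℝ (Fin p)) (T : ℕ) (k : ℤ) :
    Matrix (Fin p) (Fin p) ℝ :=
  if 0 ≤ k then (T : ℝ)⁻¹ • ∑ t ∈ Finset.Icc (k + 1) (T : ℤ), outer (v t) (v (t - k))
  else (T : ℝ)⁻¹ • ∑ t ∈ Finset.Icc (-k + 1) (T : ℤ), outer (v (t + k)) (v t)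

/-- The classical kernel HAC estimator with bandwidth `b` computed from `v_1, …, v_T`. -/
def hacEstimator (K : ℝ → ℝ) (v : ℤ → EuclideanSpace ℝ (Fin p)) (T : ℕ) (b : ℝ) :
    Matrix (Fin p) (Fin p) ℝ :=
  ((T : ℝ) / ((T : ℝ) - p)) •
    ∑ k ∈ Finset.Icc (-(T : ℤ) + 1) ((T : ℤ) - 1), K (b * k) • sampleAutocov v T k

/-- The plug-in bandwidth `(q K_{1,q}² α T / ∫ K²)^{-1/(2q+1)}`. -/
def plugInBandwidth (K : ℝ → ℝ) (q α : ℝ) (T : ℕ) : ℝ :=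
  (q * parzenCoeff K q ^ 2 * α * T / ∫ x, K x ^ 2) ^ (-1 / (2 * q + 1))

/-- `J_T = T⁻¹ ∑_{s=1}^T ∑_{t=1}^T E (V_s(β₀) V_t(β₀)')`. -/
def longRunVar (P : Measure Ω)
    (V : ℤ → EuclideanSpace ℝ (Fin d) → Ω → EuclideanSpace ℝ (Fin p))
    (β₀ : EuclideanSpace ℝ (Fin d)) (T : ℕ) : Matrix (Fin p) (Fin p) ℝ :=
  (T : ℝ)⁻¹ • ∑ s ∈ Finset.Icc (1 : ℤ) T, ∑ t ∈ Finset.Icc (1 : ℤ) T,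
    Matrix.of fun a b => ∫ ω, V s β₀ ω a * V t β₀ ω b ∂P

end Model

end HAC

end

/-!
Write `v_t = V_t(β₀)`, `δ = 1 / (2q + 1)`, and let `b` be the plug-in bandwidth. With probability
close to one, `αhat` stays in a compact subinterval of `(0, ∞)`, and then
`c₁ T ^ (-δ) ≤ b ≤ c₂ T ^ (-δ)` (`KernelClass3.plugInBandwidth_bounds`). The condition
`q > (1/ϑ - 1)/2` says exactly that `δ < ϑ`, and `ϑ < 1/2`.

The kernel has an integrable decreasing majorant, so on this event `|K (b k)|` is at most a
*nonrandom* weight `w_T(k)` with `∑_k w_T(k) = O(T ^ δ)` (`KernelClass3.exists_weight`). These weights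
remove the randomness of the bandwidth, and the estimation error splits into three parts
(`abs_error_le`).

* Replacing `V_t(βhat)` by `v_t` changes every sample autocovariance by at most `‖βhat - β₀‖` times
  an average of `sup_β ‖∂V_t(β)‖² + ‖v_t‖²`, by the mean value inequality on a convex neighbourhood
  of `β₀` in `Θ`. This is `O_P(T ^ (-ϑ))` uniformly in the lag, and `O_P(T ^ (δ - ϑ))` after
  summation against the weights.
* Every sample autocovariance of the true process has variance `O(1/T)` uniformly in the lag, because
  autocovariances and fourth order cumulants are summable
  (`DependenceCondition.exists_variance_le`). Summation against the weights gives
  `O_P(T ^ (δ - 1/2))`.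
* The bias is at most `∑_k |T/(T-p) K(b k) - 1| ‖Γ(k)‖`. It tends to zero by dominated convergence,
  as `K` is Lipschitz with `K 0 = 1` and `∑_k ‖Γ(k)‖ < ∞` (`tendsto_bias`).

The three parts are collected in a random variable that dominates the error on the good event and
tends to zero in mean (`enorm_error_le`, `tendsto_lintegral_bound`); Markov's inequality concludes.
-/

namespace HAC

/-! ### Convergence in probability -/

/-- A sequence tends to zero in probability if, outside events of arbitrarily small probability, it
is dominated by random variables whose means tend to zero. The `X T` need not be measurable. -/
theorem tendstoInMeasure_zero_of_dominated {Ω : Type*} [MeasurableSpace Ω] {P : Measure Ω}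
    {X : ℕ → Ω → ℝ}
    (h : ∀ η : ℝ≥0∞, 0 < η → ∃ Y : ℕ → Ω → ℝ≥0∞, (∀ T, AEMeasurable (Y T) P) ∧
      Tendsto (fun T => ∫⁻ ω, Y T ω ∂P) atTop (𝓝 0) ∧
      ∀ᶠ T in atTop, P {ω | ¬ ‖X T ω‖ₑ ≤ Y T ω} ≤ η) :
    TendstoInMeasure P X atTop (fun _ => 0) := by
  refine tendstoInMeasure_of_ne_top fun ε hε hεt => ?_
  rw [ENNReal.tendsto_nhds_zero]
  intro η hη
  obtain ⟨Y, hYm, hY, hXY⟩ := h (η / 2) (ENNReal.half_pos hη.ne')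
  have hdiv : Tendsto (fun T => (∫⁻ ω, Y T ω ∂P) / ε) atTop (𝓝 0) := by
    have := ENNReal.Tendsto.div_const (b := ε) hY (Or.inr hε.ne')
    simpa using this
  filter_upwards [hXY, (ENNReal.tendsto_nhds_zero.1 hdiv) (η / 2) (ENNReal.half_pos hη.ne')]
    with T h1 h2
  calc P {x | ε ≤ edist (X T x) 0}
      ≤ P ({ω | ¬ ‖X T ω‖ₑ ≤ Y T ω} ∪ {ω | ε ≤ Y T ω}) := by
        refine measure_mono fun ω hω => ?_
        by_cases hc : ‖X T ω‖ₑ ≤ Y T ω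
        · right
          simp only [Set.mem_ofPred_eq, edist_zero_right] at hω ⊢
          exact hω.trans hc
        · left; exact hc
    _ ≤ η / 2 + η / 2 := (measure_union_le _ _).trans (add_le_add h1
        ((meas_ge_le_lintegral_div (hYm T) hε.ne' hεt).trans h2))
    _ = η := ENNReal.add_halves η

theorem enorm_matrix_le_sum {p : ℕ} (A : Matrix (Fin p) (Fin p) ℝ) :
    ‖A‖ₑ ≤ ∑ i, ∑ j, ‖A i j‖ₑ := by
  have hsingle : ∀ (i j : Fin p) (x : ℝ), ‖Matrix.single i j x‖ ≤ ‖x‖ := by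
    intro i j x
    rw [Matrix.frobenius_norm_def, Finset.sum_eq_single i, Finset.sum_eq_single j]
    · rw [← Real.sqrt_eq_rpow, Matrix.single_apply_same, Real.rpow_two,
        Real.sqrt_sq (norm_nonneg _)]
    · intro b _ hb; simp [Matrix.single, hb.symm]
    · simp
    · intro b _ hb; simp [Matrix.single, hb.symm]
    · simp
  have hsum : ∀ f : Fin p → Fin p → ℝ,
      ∑ i, ∑ j, ‖f i j‖ₑ = ENNReal.ofReal (∑ i, ∑ j, ‖f i j‖) := by
    intro f
    rw [ENNReal.ofReal_sum_of_nonneg fun i _ => Finset.sum_nonneg fun j _ => norm_nonneg _]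
    refine Finset.sum_congr rfl fun i _ => ?_
    rw [ENNReal.ofReal_sum_of_nonneg fun j _ => norm_nonneg _]
    simp only [ofReal_norm]
  rw [hsum fun i j => A i j, ← ofReal_norm]
  refine ENNReal.ofReal_le_ofReal ?_
  conv_lhs => rw [Matrix.matrix_eq_sum_single A]
  exact (norm_sum_le _ _).trans (Finset.sum_le_sum fun i _ =>
    (norm_sum_le _ _).trans (Finset.sum_le_sum fun j _ => hsingle i j _))

theorem tendstoInMeasure_matrix {Ω : Type*} [MeasurableSpace Ω] {P : Measure Ω} {p : ℕ}
    {A : ℕ → Ω → Matrix (Fin p) (Fin p) ℝ}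
    (h : ∀ a b, TendstoInMeasure P (fun T ω => A T ω a b) atTop (fun _ => 0)) :
    TendstoInMeasure P A atTop (fun _ => 0) := by
  intro ε hε
  set δ : ℝ≥0∞ := ε / (p * p) with hδ
  have hδ0 : 0 < δ := ENNReal.div_pos hε.ne' (by finiteness)
  have hs : Tendsto (fun T => ∑ a, ∑ b, P {ω | δ ≤ edist (A T ω a b) 0}) atTop
      (𝓝 (∑ _a : Fin p, ∑ _b : Fin p, 0)) :=
    tendsto_finsetSum _ fun a _ => tendsto_finsetSum _ fun b _ => h a b δ hδ0
  simp only [Finset.sum_const_zero] at hs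
  refine tendsto_of_tendsto_of_tendsto_of_le_of_le tendsto_const_nhds hs
    (fun _ => zero_le) fun T => ?_
  refine (measure_mono (t := ⋃ a, ⋃ b, {ω | δ ≤ edist (A T ω a b) 0}) fun ω hω => ?_).trans
    ((measure_iUnion_fintype_le _ _).trans
      (Finset.sum_le_sum fun a _ => measure_iUnion_fintype_le _ _))
  by_contra hc
  simp only [Set.mem_iUnion, Set.mem_ofPred_eq, not_exists, not_le, edist_zero_right] at hc hω
  have h1 := hω.trans (enorm_matrix_le_sum _)
  rcases Nat.eq_zero_or_pos p with rfl | hp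
  · simp at h1; exact hε.ne' h1
  have : Nonempty (Fin p) := ⟨⟨0, hp⟩⟩
  have h2 : ∑ i, ∑ j, ‖A T ω i j‖ₑ < ∑ _i : Fin p, ∑ _j : Fin p, δ :=
    ENNReal.sum_lt_sum_of_nonempty Finset.univ_nonempty fun i _ =>
      ENNReal.sum_lt_sum_of_nonempty Finset.univ_nonempty fun j _ => hc i j
  have h3 : ∑ _i : Fin p, ∑ _j : Fin p, δ = ε := by
    simp only [Finset.sum_const, Finset.card_univ, Fintype.card_fin, nsmul_eq_mul]
    rw [← mul_assoc, hδ, ENNReal.mul_div_cancel (by simpa using hp.ne') (by finiteness)]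
  exact absurd (h1.trans_lt h2) (by rw [h3]; exact lt_irrefl _)

/-! ### Kernels and bandwidths -/

/-- The decay of the kernel and `|K| ≤ 1` combine to a majorant without singularity at zero. -/
theorem KernelClass3.exists_majorant {K : ℝ → ℝ} {q : ℝ} (hK : KernelClass3 K q) :
    ∃ C : ℝ, 0 ≤ C ∧ ∃ β : ℝ, 1 < β ∧ ∀ y, |K y| ≤ C * (1 + |y|) ^ (-β) := by
  obtain ⟨β, hβ, C₁, hC₁⟩ := hK.decay
  have hβ1 : 1 < β := by
    have := hK.q_pos
    have : 0 < 1 / q := by positivity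
    linarith
  have h1 : 0 < max 1 C₁ := lt_of_lt_of_le one_pos (le_max_left _ _)
  refine ⟨max 1 C₁ * 2 ^ β, by positivity, β, hβ1, fun y => ?_⟩
  have h2 : (0 : ℝ) < 2 ^ β := by positivity
  -- `2 ^ β (1 + |y|) ^ (-β) = ((1 + |y|) / 2) ^ (-β)`
  have hrw : max 1 C₁ * 2 ^ β * (1 + |y|) ^ (-β) = max 1 C₁ * ((1 + |y|) / 2) ^ (-β) := by
    rw [Real.div_rpow (by positivity) (by norm_num), Real.rpow_neg (by norm_num : (0:ℝ) ≤ 2)]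
    field_simp
  rw [hrw]
  rcases le_total |y| 1 with hy | hy
  · have hKy : |K y| ≤ 1 := abs_le.2 (hK.mem_Icc y)
    have h3 : 1 ≤ ((1 + |y|) / 2) ^ (-β) := by
      apply Real.one_le_rpow_of_pos_of_le_one_of_nonpos <;> first | positivity | linarith
    calc |K y| ≤ 1 * 1 := by simpa using hKy
      _ ≤ _ := mul_le_mul (le_max_left _ _) h3 zero_le_one h1.le
  · have hy0 : y ≠ 0 := by rintro rfl; norm_num at hy
    refine (hC₁ y hy0).trans ?_
    gcongr ?_ * ?_
    · exact le_max_right _ _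
    · exact Real.rpow_le_rpow_of_nonpos (by positivity) (by linarith) (by linarith)

/-- The denominator in the plug-in bandwidth does not vanish. -/
theorem KernelClass3.integral_sq_pos {K : ℝ → ℝ} {q : ℝ} (hK : KernelClass3 K q) :
    0 < ∫ x, K x ^ 2 := by
  obtain ⟨L, hL⟩ := hK.lipschitz
  have hc : Continuous K := by
    refine (LipschitzWith.of_dist_le_mul (K := L.toNNReal) fun x y => ?_).continuous
    rw [Real.dist_eq, Real.dist_eq]
    exact (hL x y).trans (mul_le_mul_of_nonneg_right (Real.le_coe_toNNReal L) (abs_nonneg _))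
  rw [integral_pos_iff_support_of_nonneg (fun x => sq_nonneg _) hK.sq_integrable]
  refine (IsOpen.measure_pos _ ?_ ⟨0, ?_⟩)
  · exact (hc.pow 2).isOpen_support
  · simp [hK.at_zero]

/-- Comparison of a Riemann sum with mesh `h` of the decreasing function `(1 + x) ^ (-β)` with its
integral over `(0, ∞)`. -/
theorem exists_sum_rpow_le {β : ℝ} (hβ : 1 < β) :
    ∃ C : ℝ, 0 ≤ C ∧ ∀ h : ℝ, 0 < h → ∀ N : ℕ,
      ∑ k ∈ Finset.range N, (1 + h * ((k + 1 : ℕ) : ℝ)) ^ (-β) ≤ C / h := by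
  have hint : IntegrableOn (fun x : ℝ => (1 + x) ^ (-β)) (Set.Ioi 0) := by
    have := integrableOn_add_rpow_Ioi_of_lt (a := -β) (c := 0) (m := 1) (by linarith) (by norm_num)
    simpa [add_comm] using this
  have hpos : ∀ x ∈ Set.Ioi (0 : ℝ), 0 ≤ (1 + x) ^ (-β) := fun x hx => by
    have : (0:ℝ) < x := hx
    positivity
  refine ⟨∫ x in Set.Ioi (0 : ℝ), (1 + x) ^ (-β),
    setIntegral_nonneg measurableSet_Ioi hpos, fun h hh N => ?_⟩
  have hanti : AntitoneOn (fun x : ℝ => (1 + h * x) ^ (-β)) (Set.Icc (0:ℝ) (0 + (N : ℝ))) := by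
    intro x hx y hy hxy
    have := hx.1
    exact Real.rpow_le_rpow_of_nonpos (by positivity) (by gcongr) (by linarith)
  have h1 := hanti.sum_le_integral
  simp only [zero_add] at h1
  refine h1.trans ?_
  rw [intervalIntegral.integral_comp_mul_left (fun x => (1 + x) ^ (-β)) hh.ne', mul_zero,
    intervalIntegral.integral_of_le (by positivity), smul_eq_mul, inv_mul_eq_div]
  gcongr
  · exact (ae_restrict_iff' measurableSet_Ioi).2 (.of_forall hpos)
  · exact Set.Ioc_subset_Ioi_self

theorem exists_sum_weight_le {β : ℝ} (hβ : 1 < β) :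
    ∃ C : ℝ, 0 ≤ C ∧ ∀ h : ℝ, 0 < h → ∀ N : ℕ,
      ∑ k ∈ Finset.Icc (-(N : ℤ) + 1) ((N : ℤ) - 1), (1 + h * |(k : ℝ)|) ^ (-β) ≤ 1 + C / h := by
  obtain ⟨C, hC, hsum⟩ := exists_sum_rpow_le hβ
  refine ⟨2 * C, by positivity, fun h hh N => ?_⟩
  have key : ∀ N : ℕ, ∑ k ∈ Finset.Icc (-(N : ℤ)) (N : ℤ), (1 + h * |(k : ℝ)|) ^ (-β)
      = 1 + 2 * ∑ k ∈ Finset.range N, (1 + h * ((k + 1 : ℕ) : ℝ)) ^ (-β) := by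
    intro N
    induction N with
    | zero => simp
    | succ n ih =>
      have : Finset.Icc (-((n + 1 : ℕ) : ℤ)) ((n + 1 : ℕ) : ℤ)
          = insert (-((n + 1 : ℕ) : ℤ)) (insert ((n + 1 : ℕ) : ℤ)
            (Finset.Icc (-(n : ℤ)) (n : ℤ))) := by
        ext x; simp only [Finset.mem_Icc, Finset.mem_insert]; push_cast; omega
      rw [this, Finset.sum_insert, Finset.sum_insert, ih, Finset.sum_range_succ]
      · have h1 : |(n : ℝ) + 1| = n + 1 := abs_of_nonneg (by positivity)
        have h2 : |(-1 : ℝ) + -(n : ℝ)| = n + 1 := by rw [← abs_neg]; simp [h1, add_comm]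
        push_cast
        rw [show -((n:ℝ)+1) = -1 + -(n : ℝ) by ring, h1, h2]; ring
      · simp
      · simp only [Finset.mem_Icc, Finset.mem_insert]; push_cast; omega
  calc _ ≤ ∑ k ∈ Finset.Icc (-(N : ℤ)) (N : ℤ), (1 + h * |(k : ℝ)|) ^ (-β) := by
        refine Finset.sum_le_sum_of_subset_of_nonneg
          (Finset.Icc_subset_Icc (by omega) (by omega)) fun k _ _ => by positivity
    _ ≤ 1 + 2 * (C / h) := by rw [key]; gcongr; exact hsum h hh N
    _ = _ := by ring

theorem KernelClass3.plugInBandwidth_bounds {K : ℝ → ℝ} {q : ℝ} (hK : KernelClass3 K q)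
    {m M : ℝ} (hm : 0 < m) (hM : 0 < M) :
    ∃ c₁ c₂ : ℝ, 0 < c₁ ∧ 0 < c₂ ∧ ∀ T : ℕ, 0 < T → ∀ α : ℝ, m ≤ α → α ≤ M →
      c₁ * (T : ℝ) ^ (-1 / (2 * q + 1)) ≤ plugInBandwidth K q α T ∧
      plugInBandwidth K q α T ≤ c₂ * (T : ℝ) ^ (-1 / (2 * q + 1)) := by
  have hq := hK.q_pos
  obtain ⟨c, hc, hlim⟩ := hK.parzen_pos
  have hpc : parzenCoeff K q = c := hlim.limUnder_eq
  have hI := hK.integral_sq_pos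
  set I := ∫ x, K x ^ 2
  set A := q * c ^ 2 / I
  have hA : 0 < A := by positivity
  have he : -1 / (2 * q + 1) ≤ 0 := div_nonpos_of_nonpos_of_nonneg (by norm_num) (by positivity)
  refine ⟨(A * M) ^ (-1 / (2 * q + 1)), (A * m) ^ (-1 / (2 * q + 1)), by positivity,
    by positivity, fun T hT α h1 h2 => ?_⟩
  have hα : 0 < α := hm.trans_le h1
  have hTr : (0 : ℝ) < T := by exact_mod_cast hT
  have hb : plugInBandwidth K q α T
      = (A * α) ^ (-1 / (2 * q + 1)) * (T : ℝ) ^ (-1 / (2 * q + 1)) := by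
    rw [plugInBandwidth, hpc, ← Real.mul_rpow (by positivity) hTr.le]
    congr 1
    simp only [A, I]; ring
  rw [hb]
  constructor <;> gcongr ?_ * _ <;>
    exact Real.rpow_le_rpow_of_nonpos (by positivity) (by gcongr) he

/-! ### Sums over pairs of time points at a given lag -/

/-- The times `t` in `{1, …, T}` for which `t - k` is in `{1, …, T}` as well. -/
noncomputable def lagSet (T : ℕ) (k : ℤ) : Finset ℤ :=
  (Finset.Icc (1 : ℤ) T).filter fun t => t - k ∈ Finset.Icc (1 : ℤ) T

theorem card_lagSet_le (T : ℕ) (k : ℤ) : ((lagSet T k).card : ℝ) ≤ T := by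
  have h : (lagSet T k).card ≤ (Finset.Icc (1 : ℤ) T).card := Finset.card_filter_le _ _
  have : (Finset.Icc (1 : ℤ) T).card = T := by simp
  exact_mod_cast this ▸ h

/-- The two cases of the definition, for lags of either sign, are one sum over `lagSet T k`. -/
theorem sampleAutocov_apply {p : ℕ} (v : ℤ → EuclideanSpace ℝ (Fin p)) (T : ℕ) (k : ℤ)
    (a b : Fin p) :
    sampleAutocov v T k a b = (T : ℝ)⁻¹ * ∑ t ∈ lagSet T k, v t a * v (t - k) b := by
  unfold sampleAutocov
  split_ifs with hk
  · have : lagSet T k = Finset.Icc (k + 1) (T : ℤ) := by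
      ext t; simp only [lagSet, Finset.mem_filter, Finset.mem_Icc]; omega
    rw [this, Matrix.smul_apply, Matrix.sum_apply]; rfl
  · rw [Matrix.smul_apply, Matrix.sum_apply, smul_eq_mul]
    congr 1
    refine Finset.sum_nbij' (· + k) (· - k) ?_ ?_ ?_ ?_ ?_
    · intro t; simp only [lagSet, Finset.mem_filter, Finset.mem_Icc]; omega
    · intro t; simp only [lagSet, Finset.mem_filter, Finset.mem_Icc]; omega
    · intro t _; simp
    · intro t _; simp
    · intro t _; simp [outer]

theorem sum_sum_eq_sum_lagSet (T : ℕ) (f : ℤ → ℤ → ℝ) :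
    ∑ s ∈ Finset.Icc (1 : ℤ) T, ∑ t ∈ Finset.Icc (1 : ℤ) T, f s t
      = ∑ k ∈ Finset.Icc (-(T : ℤ) + 1) ((T : ℤ) - 1), ∑ t ∈ lagSet T k, f t (t - k) := by
  rw [Finset.sum_sigma', Finset.sum_sigma']
  refine Finset.sum_nbij' (fun x => ⟨x.1 - x.2, x.1⟩) (fun y => ⟨y.2, y.2 - y.1⟩) ?_ ?_ ?_ ?_ ?_
  · rintro ⟨s, t⟩; simp only [lagSet, Finset.mem_sigma, Finset.mem_filter, Finset.mem_Icc]; omega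
  · rintro ⟨s, t⟩; simp only [lagSet, Finset.mem_sigma, Finset.mem_filter, Finset.mem_Icc]; omega
  · rintro ⟨s, t⟩ _; simp
  · rintro ⟨s, t⟩ _; simp
  · rintro ⟨s, t⟩ _; simp

/-! ### Sample autocovariances of a fourth order stationary process -/

section Moments

variable {Ω : Type*} [MeasurableSpace Ω] {P : Measure Ω} {ι : Type*} {X : ℤ → Ω → ι → ℝ}

theorem FourthOrderStationary.integral_mul (hX : FourthOrderStationary P X) (s t : ℤ) (a b : ι) :
    ∫ ω, X s ω a * X t ω b ∂P = autocov P X (s - t) a b := by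
  have := hX.shift 2 (by norm_num) ![0, t - s] ![a, b] s
  simpa [autocov, Fin.prod_univ_two] using this

theorem FourthOrderStationary.integral_mul_mul_mul (hX : FourthOrderStationary P X)
    (s t u v : ℤ) (a b c d : ι) :
    ∫ ω, X s ω a * X t ω b * X u ω c * X v ω d ∂P
      = ∫ ω, X 0 ω a * X (t - s) ω b * X (u - s) ω c * X (v - s) ω d ∂P := by
  have := hX.shift 4 le_rfl ![0, t - s, u - s, v - s] ![a, b, c, d] s
  simpa [Fin.prod_univ_four] using this

theorem FourthOrderStationary.memLp_mul (hX : FourthOrderStationary P X) (s t : ℤ) (a b : ι) :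
    MemLp (fun ω => X s ω a * X t ω b) 2 P := by
  have : ENNReal.HolderTriple 4 4 2 := ⟨by
    rw [← two_mul, show (4 : ℝ≥0∞) = 2 * 2 by norm_num,
      ENNReal.mul_inv (by simp) (by simp), ← mul_assoc, ENNReal.mul_inv_cancel (by simp) (by simp),
      one_mul]⟩
  exact (hX.memLp t b).mul (hX.memLp s a)

/-- The covariance of two lagged products, in terms of the fourth order cumulant and the
autocovariances. -/
theorem FourthOrderStationary.integral_mul_mul_mul_eq (hX : FourthOrderStationary P X)
    (k s t : ℤ) (a b : ι) :
    ∫ ω, (X s ω a * X (s - k) ω b) * (X t ω a * X (t - k) ω b) ∂P - autocov P X k a b ^ 2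
      = cumulant4 P X a b a b (-k) (t - s) (t - s - k)
        + (autocov P X (s - t) a a * autocov P X (s - t) b b
        + autocov P X (s - t + k) a b * autocov P X (s - t - k) b a) := by
  have h := hX.integral_mul_mul_mul s (s - k) t (t - k) a b a b
  simp only [mul_assoc] at h
  simp only [cumulant4, mul_assoc, h, hX.integral_mul]
  rw [show s - k - s = -k by ring, show t - k - s = t - s - k by ring]
  rw [show 0 - (t - s) = s - t by ring, show -k - (t - s - k) = s - t by ring,
    show 0 - (t - s - k) = s - t + k by ring, show -k - (t - s) = s - t - k by ring,
    show t - s - (t - s - k) = k by ring, show 0 - -k = k by ring]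
  ring

theorem abs_apply_le_frobenius [Fintype ι] (A : Matrix ι ι ℝ) (a b : ι) : |A a b| ≤ ‖A‖ := by
  rw [Matrix.frobenius_norm_def, ← Real.sqrt_eq_rpow]
  refine Real.le_sqrt_of_sq_le ?_
  have h1 : ‖A a b‖ ^ (2 : ℝ) ≤ ∑ j, ‖A a j‖ ^ (2 : ℝ) :=
    Finset.single_le_sum (f := fun j => ‖A a j‖ ^ (2 : ℝ)) (fun j _ => by positivity)
      (Finset.mem_univ b)
  have h2 : ∑ j, ‖A a j‖ ^ (2 : ℝ) ≤ ∑ i, ∑ j, ‖A i j‖ ^ (2 : ℝ) :=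
    Finset.single_le_sum (f := fun i => ∑ j, ‖A i j‖ ^ (2 : ℝ)) (fun i _ => by positivity)
      (Finset.mem_univ a)
  simpa using h1.trans h2

theorem sum_comp_le_tsum {α β : Type*} {f : β → ℝ} (hf : Summable f) (h0 : ∀ y, 0 ≤ f y)
    {g : α → β} (hg : Function.Injective g) (s : Finset α) : ∑ x ∈ s, f (g x) ≤ ∑' y, f y :=
  ((hf.comp_injective hg).sum_le_tsum s fun _ _ => h0 _).trans
    (tsum_comp_le_tsum_of_inj hf h0 hg)

/-- The variance of a sum of `n` lagged products is at most a constant times `n`, uniformly in the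
lag. By stationarity each covariance of two such products is a fourth order cumulant plus products
of two autocovariances, and all of these are absolutely summable. -/
theorem DependenceCondition.exists_variance_le [Fintype ι] [IsProbabilityMeasure P]
    (hX : DependenceCondition P X) (a b : ι) :
    ∃ C : ℝ, 0 ≤ C ∧ ∀ (k : ℤ) (I : Finset ℤ),
      ∫ ω, (∑ t ∈ I, (X t ω a * X (t - k) ω b - autocov P X k a b)) ^ 2 ∂P ≤ C * I.card := by
  set G := ∑' k, ‖autocov P X k‖
  set κ := ∑' m : ℤ × ℤ × ℤ, |cumulant4 P X a b a b m.1 m.2.1 m.2.2|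
  have hle : ∀ k (c d : ι), |autocov P X k c d| ≤ G := fun k c d =>
    (abs_apply_le_frobenius _ c d).trans
      (hX.summable_autocov.le_tsum k fun _ _ => norm_nonneg _)
  have hG0 : 0 ≤ G := tsum_nonneg fun _ => norm_nonneg _
  have hκ0 : 0 ≤ κ := tsum_nonneg fun _ => abs_nonneg _
  refine ⟨κ + (G * G + G * G), by positivity, fun k I => ?_⟩
  set γ := autocov P X k a b with hγ
  have hL2 : ∀ t, MemLp (fun ω => X t ω a * X (t - k) ω b - γ) 2 P := fun t =>
    (hX.stationary.memLp_mul t (t - k) a b).sub (memLp_const γ)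
  have hint : ∀ s t, Integrable (fun ω => (X s ω a * X (s - k) ω b - γ)
      * (X t ω a * X (t - k) ω b - γ)) P := fun s t => (hL2 s).integrable_mul (hL2 t)
  have hpair : ∀ s t, Integrable (fun ω => (X s ω a * X (s - k) ω b)
      * (X t ω a * X (t - k) ω b)) P := fun s t =>
    (hX.stationary.memLp_mul s (s - k) a b).integrable_mul
      (hX.stationary.memLp_mul t (t - k) a b)
  have hone : ∀ t, Integrable (fun ω => X t ω a * X (t - k) ω b) P := fun t =>
    (hX.stationary.memLp_mul t (t - k) a b).integrable (by norm_num)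
  have hcov : ∀ s t, ∫ ω, (X s ω a * X (s - k) ω b - γ) * (X t ω a * X (t - k) ω b - γ) ∂P
      = ∫ ω, (X s ω a * X (s - k) ω b) * (X t ω a * X (t - k) ω b) ∂P - γ ^ 2 := by
    intro s t
    have h1 : ∀ t, ∫ ω, X t ω a * X (t - k) ω b ∂P = γ := fun t => by
      rw [hX.stationary.integral_mul, sub_sub_cancel]
    have : ∀ ω, (X s ω a * X (s - k) ω b - γ) * (X t ω a * X (t - k) ω b - γ)
        = (X s ω a * X (s - k) ω b) * (X t ω a * X (t - k) ω b)
          - γ * (X s ω a * X (s - k) ω b) - γ * (X t ω a * X (t - k) ω b) + γ ^ 2 :=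
      fun ω => by ring
    have i1 : Integrable (fun ω => (X s ω a * X (s - k) ω b) * (X t ω a * X (t - k) ω b)
        - γ * (X s ω a * X (s - k) ω b)) P := (hpair s t).sub ((hone s).const_mul γ)
    have i2 : Integrable (fun ω => (X s ω a * X (s - k) ω b) * (X t ω a * X (t - k) ω b)
        - γ * (X s ω a * X (s - k) ω b) - γ * (X t ω a * X (t - k) ω b)) P :=
      i1.sub ((hone t).const_mul γ)
    simp only [this]
    rw [integral_add i2 (integrable_const _), integral_sub i1 ((hone t).const_mul γ),
      integral_sub (hpair s t) ((hone s).const_mul γ), integral_const_mul, integral_const_mul,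
      h1, h1, integral_const, probReal_univ, one_smul]
    ring
  simp only [sq (∑ t ∈ I, _), Finset.sum_mul_sum]
  rw [integral_finsetSum _ fun s _ => integrable_finsetSum _ fun t _ => hint s t]
  have hrow : ∀ s ∈ I, ∫ ω, ∑ t ∈ I, (X s ω a * X (s - k) ω b - γ)
      * (X t ω a * X (t - k) ω b - γ) ∂P ≤ κ + (G * G + G * G) := by
    intro s _
    rw [integral_finsetSum _ fun t _ => hint s t]
    simp only [hcov]
    simp only [hγ, hX.stationary.integral_mul_mul_mul_eq]
    rw [Finset.sum_add_distrib, Finset.sum_add_distrib]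
    refine add_le_add ?_ (add_le_add ?_ ?_)
    · refine (Finset.sum_le_sum fun t _ => le_abs_self _).trans ?_
      exact sum_comp_le_tsum (hX.summable_cumulant a b a b) (fun _ => abs_nonneg _)
        (g := fun t : ℤ => (-k, t - s, t - s - k)) (fun t t' h => by simpa using h) I
    · refine (Finset.sum_le_sum (g := fun t => ‖autocov P X (s - t)‖ * G) fun t _ => ?_).trans ?_
      · refine (le_abs_self _).trans ?_
        rw [abs_mul]
        exact mul_le_mul (abs_apply_le_frobenius _ _ _) (hle _ _ _) (abs_nonneg _) (norm_nonneg _)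
      · rw [← Finset.sum_mul]
        refine mul_le_mul_of_nonneg_right ?_ hG0
        exact sum_comp_le_tsum hX.summable_autocov (fun _ => norm_nonneg _)
          (g := fun t : ℤ => s - t) (fun t t' h => by simpa using h) I
    · refine (Finset.sum_le_sum (g := fun t => ‖autocov P X (s - t + k)‖ * G)
        fun t _ => ?_).trans ?_
      · refine (le_abs_self _).trans ?_
        rw [abs_mul]
        exact mul_le_mul (abs_apply_le_frobenius _ _ _) (hle _ _ _) (abs_nonneg _) (norm_nonneg _)
      · rw [← Finset.sum_mul]
        refine mul_le_mul_of_nonneg_right ?_ hG0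
        exact sum_comp_le_tsum hX.summable_autocov (fun _ => norm_nonneg _)
          (g := fun t : ℤ => s - t + k) (fun t t' h => by simpa using h) I
  calc _ ≤ ∑ _s ∈ I, (κ + (G * G + G * G)) := Finset.sum_le_sum hrow
    _ = _ := by rw [Finset.sum_const, nsmul_eq_mul, mul_comm]

/-- The centred sample autocovariances, multiplied by `T`, are of order `√T` in mean, uniformly in the
lag. -/
theorem DependenceCondition.exists_lintegral_sum_lagSet_le [Fintype ι] [IsProbabilityMeasure P]
    (hX : DependenceCondition P X) (a b : ι) :
    ∃ C : ℝ, 0 ≤ C ∧ ∀ (T : ℕ) (k : ℤ), 0 < T →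
      ∫⁻ ω, ‖∑ t ∈ lagSet T k, (X t ω a * X (t - k) ω b - autocov P X k a b)‖ₑ ∂P
        ≤ ENNReal.ofReal (C * √T) := by
  obtain ⟨C, hC, hvar⟩ := hX.exists_variance_le a b
  refine ⟨C + 1, by positivity, fun T k hT => ?_⟩
  set S : Ω → ℝ := fun ω => ∑ t ∈ lagSet T k, (X t ω a * X (t - k) ω b - autocov P X k a b)
  have hL2 : MemLp S 2 P := memLp_finsetSum _ fun t _ =>
    (hX.stationary.memLp_mul t (t - k) a b).sub (memLp_const _)
  have hT0 : (0 : ℝ) < √T := Real.sqrt_pos.2 (by exact_mod_cast hT)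
  have hTT : √(T : ℝ) * √T = T := Real.mul_self_sqrt (by positivity)
  -- by `2 x y ≤ x ^ 2 + y ^ 2` the bound on the second moment gives one on the first
  have hpt : ∀ ω, ‖S ω‖ ≤ (√T)⁻¹ * S ω ^ 2 + √T := fun ω => by
    rw [← sub_nonneg]
    have : (√T)⁻¹ * S ω ^ 2 + √T - ‖S ω‖
        = (√T)⁻¹ * ((|S ω| - √T) ^ 2 + √T * |S ω|) := by
      rw [← sq_abs (S ω), Real.norm_eq_abs]; field_simp; ring
    rw [this]; positivity
  have hi1 : Integrable S P := hL2.integrable (by norm_num)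
  have hi2 : Integrable (fun ω => (√T)⁻¹ * S ω ^ 2) P := hL2.integrable_sq.const_mul _
  rw [← ofReal_integral_norm_eq_lintegral_enorm hi1]
  refine ENNReal.ofReal_le_ofReal ?_
  calc ∫ ω, ‖S ω‖ ∂P ≤ ∫ ω, ((√T)⁻¹ * S ω ^ 2 + √T) ∂P :=
        integral_mono hi1.norm (hi2.add (integrable_const _)) hpt
    _ = (√T)⁻¹ * ∫ ω, S ω ^ 2 ∂P + √T := by
        rw [integral_add hi2 (integrable_const _), integral_const_mul]; simp
    _ ≤ (√T)⁻¹ * (C * T) + √T := by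
        gcongr
        exact (hvar k _).trans (mul_le_mul_of_nonneg_left (card_lagSet_le T k) hC)
    _ = (C + 1) * √T := by
        have : (√T)⁻¹ * (C * T) = C * √T := by
          rw [inv_mul_eq_div, div_eq_iff hT0.ne', mul_assoc, hTT]
        rw [this]; ring

end Moments

/-! ### Replacing the true parameter by its estimate -/

/-- Mean value inequality between `x` and a point of `Θ` in a ball around `x` where `Θ` is convex. -/
theorem norm_sub_le_sqrt_iSup_fderivWithin {E F : Type*} [NormedAddCommGroup E] [NormedSpace ℝ E]
    [NormedAddCommGroup F] [NormedSpace ℝ F] {f : E → F} {Θ : Set E} {x y : E} {r : ℝ}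
    (hconv : Convex ℝ (Θ ∩ Metric.ball x r)) (hf : DifferentiableOn ℝ f Θ)
    (hfin : (⨆ z ∈ Θ, ‖fderivWithin ℝ f Θ z‖ₑ ^ 2) ≠ ∞) (hx : x ∈ Θ) (hy : y ∈ Θ)
    (hyx : ‖y - x‖ < r) :
    ‖f y - f x‖ ≤ √(⨆ z ∈ Θ, ‖fderivWithin ℝ f Θ z‖ₑ ^ 2).toReal * ‖y - x‖ := by
  refine hconv.norm_image_sub_le_of_norm_hasFDerivWithin_le (f' := fderivWithin ℝ f Θ)
    (fun z hz => (hf z hz.1).hasFDerivWithinAt.mono Set.inter_subset_left) (fun z hz => ?_)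
    ⟨hx, Metric.mem_ball_self ((norm_nonneg _).trans_lt hyx)⟩
    ⟨hy, by rwa [Metric.mem_ball, dist_eq_norm]⟩
  refine Real.le_sqrt_of_sq_le ?_
  have h := ENNReal.toReal_mono hfin
    (le_iSup₂ (f := fun z (_ : z ∈ Θ) => ‖fderivWithin ℝ f Θ z‖ₑ ^ 2) z hz.1)
  simpa using h

/-- Perturbation of a product. Cross terms are bounded by sums of squares, so that averages over time
of the right-hand side are controlled by second moments at single times. -/
theorem abs_mul_sub_mul_le {x y x' y' d e m n r : ℝ} (hd : 0 ≤ d) (he : 0 ≤ e)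
    (hr1 : r ≤ 1) (hx : |x' - x| ≤ √d * r) (hy : |y' - y| ≤ √e * r)
    (hm : x ^ 2 ≤ m) (hn : y ^ 2 ≤ n) (hr : 0 ≤ r) :
    |x' * y' - x * y| ≤ r * ((d + m) + (e + n)) := by
  have hd2 := Real.sq_sqrt hd
  have he2 := Real.sq_sqrt he
  have hd0 := Real.sqrt_nonneg d
  have he0 := Real.sqrt_nonneg e
  set D := √d
  set E := √e
  have h1 : |x' * y' - x * y| ≤ |x' - x| * |y| + |x| * |y' - y| + |x' - x| * |y' - y| := by
    rw [show x' * y' - x * y = (x' - x) * y + x * (y' - y) + (x' - x) * (y' - y) by ring,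
      ← abs_mul, ← abs_mul, ← abs_mul]
    exact abs_add_three _ _ _
  have h2 : |x' - x| * |y' - y| ≤ (D * r) * (E * 1) :=
    mul_le_mul hx (hy.trans (by gcongr)) (abs_nonneg _) (by positivity)
  calc |x' * y' - x * y| ≤ (D * r) * |y| + |x| * (E * r) + (D * r) * (E * 1) :=
        h1.trans (by gcongr)
    _ = r * (D * |y| + |x| * E + D * E) := by ring
    _ ≤ r * ((d + m) + (e + n)) := by
        refine mul_le_mul_of_nonneg_left ?_ hr
        nlinarith [sq_nonneg (D - |y|), sq_nonneg (|x| - E), sq_nonneg (D - E), sq_abs x, sq_abs y]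

/-! ### Decomposition of the estimation error -/

theorem hacEstimator_apply {p : ℕ} (K : ℝ → ℝ) (v : ℤ → EuclideanSpace ℝ (Fin p)) (T : ℕ) (b : ℝ)
    (i j : Fin p) :
    hacEstimator K v T b i j = (T : ℝ) / ((T : ℝ) - p) *
      ∑ k ∈ Finset.Icc (-(T : ℤ) + 1) ((T : ℤ) - 1),
        K (b * k) * ((T : ℝ)⁻¹ * ∑ t ∈ lagSet T k, v t i * v (t - k) j) := by
  simp only [hacEstimator, Matrix.smul_apply, Matrix.sum_apply, smul_eq_mul, sampleAutocov_apply]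

theorem longRunVar_apply {Ω : Type*} [MeasurableSpace Ω] {P : Measure Ω} {p d : ℕ}
    {V : ℤ → EuclideanSpace ℝ (Fin d) → Ω → EuclideanSpace ℝ (Fin p)}
    {β₀ : EuclideanSpace ℝ (Fin d)} (hV : FourthOrderStationary P (trueProcess V β₀)) (T : ℕ)
    (i j : Fin p) :
    longRunVar P V β₀ T i j = (T : ℝ)⁻¹ * ∑ k ∈ Finset.Icc (-(T : ℤ) + 1) ((T : ℤ) - 1),
      ∑ _t ∈ lagSet T k, autocov P (trueProcess V β₀) k i j := by
  have h := sum_sum_eq_sum_lagSet T fun s t => autocov P (trueProcess V β₀) (s - t) i j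
  simp only [sub_sub_cancel] at h
  rw [← h]
  simp only [longRunVar, Matrix.smul_apply, Matrix.sum_apply, smul_eq_mul, Matrix.of_apply,
    ← hV.integral_mul, trueProcess]

theorem sum_lagSet_add_le {Z : ℤ → ℝ} (hZ : ∀ t, 0 ≤ Z t) (T : ℕ) (k : ℤ) :
    ∑ t ∈ lagSet T k, (Z t + Z (t - k)) ≤ 2 * ∑ t ∈ Finset.Icc (1 : ℤ) T, Z t := by
  rw [Finset.sum_add_distrib, two_mul]
  refine add_le_add (Finset.sum_le_sum_of_subset_of_nonneg (Finset.filter_subset _ _)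
    fun t _ _ => hZ t) ?_
  rw [← Finset.sum_image (f := Z) (g := fun t => t - k) (fun t _ t' _ h => by simpa using h)]
  refine Finset.sum_le_sum_of_subset_of_nonneg ?_ fun t _ _ => hZ t
  intro t ht
  obtain ⟨s, hs, rfl⟩ := Finset.mem_image.1 ht
  exact (Finset.mem_filter.1 hs).2

/-- Deterministic bound for one entry of the estimation error. The three sums are the effect of
evaluating the data `v'` at the estimated parameter, the sampling error of the autocovariances of
the true data `v`, and the bias. -/
theorem abs_error_le {T : ℕ} {c r : ℝ} {κ w γ Z : ℤ → ℝ} {x y x' y' : ℤ → ℝ}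
    (hc : 0 ≤ c) (hc2 : c ≤ 2) (hw : ∀ k, |κ k| ≤ w k) (hZ : ∀ t, 0 ≤ Z t) (hr : 0 ≤ r)
    (hxy : ∀ s ∈ Finset.Icc (1 : ℤ) T, ∀ t ∈ Finset.Icc (1 : ℤ) T,
      |x' s * y' t - x s * y t| ≤ r * (Z s + Z t)) (I : Finset ℤ) :
    |c * ∑ k ∈ I, κ k * ((T : ℝ)⁻¹ * ∑ t ∈ lagSet T k, x' t * y' (t - k))
        - (T : ℝ)⁻¹ * ∑ k ∈ I, ∑ _t ∈ lagSet T k, γ k|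
      ≤ 4 * r * (∑ k ∈ I, w k) * (T : ℝ)⁻¹ * ∑ t ∈ Finset.Icc (1 : ℤ) T, Z t
        + ∑ k ∈ I, 2 * w k * (T : ℝ)⁻¹ * |∑ t ∈ lagSet T k, (x t * y (t - k) - γ k)|
        + ∑ k ∈ I, |c * κ k - 1| * |γ k| := by
  have hw0 : ∀ k, 0 ≤ w k := fun k => (abs_nonneg _).trans (hw k)
  have hT0 : (0 : ℝ) ≤ (T : ℝ)⁻¹ := by positivity
  have hcκ : ∀ k, |c * κ k * (T : ℝ)⁻¹| ≤ 2 * w k * (T : ℝ)⁻¹ := fun k => by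
    rw [abs_mul, abs_mul, abs_of_nonneg hc, abs_of_nonneg hT0]
    gcongr
    exact hw k
  have hdec : c * ∑ k ∈ I, κ k * ((T : ℝ)⁻¹ * ∑ t ∈ lagSet T k, x' t * y' (t - k))
        - (T : ℝ)⁻¹ * ∑ k ∈ I, ∑ _t ∈ lagSet T k, γ k
      = ∑ k ∈ I, (c * κ k * (T : ℝ)⁻¹ * ∑ t ∈ lagSet T k, (x' t * y' (t - k) - x t * y (t - k))
        + c * κ k * (T : ℝ)⁻¹ * ∑ t ∈ lagSet T k, (x t * y (t - k) - γ k)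
        + (c * κ k - 1) * γ k * ((lagSet T k).card * (T : ℝ)⁻¹)) := by
    rw [Finset.mul_sum, Finset.mul_sum, ← Finset.sum_sub_distrib]
    refine Finset.sum_congr rfl fun k _ => ?_
    simp only [Finset.sum_sub_distrib, Finset.sum_const, nsmul_eq_mul]
    ring
  rw [hdec]
  refine (Finset.abs_sum_le_sum_abs _ _).trans ?_
  have hsplit : 4 * r * (∑ k ∈ I, w k) * (T : ℝ)⁻¹ * ∑ t ∈ Finset.Icc (1 : ℤ) T, Z t
      = ∑ k ∈ I, 2 * w k * (T : ℝ)⁻¹ * (r * (2 * ∑ t ∈ Finset.Icc (1 : ℤ) T, Z t)) := by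
    simp only [Finset.mul_sum (s := I), Finset.sum_mul (s := I)]
    exact Finset.sum_congr rfl fun k _ => by ring
  rw [hsplit, ← Finset.sum_add_distrib, ← Finset.sum_add_distrib]
  refine Finset.sum_le_sum fun k _ => ?_
  refine (abs_add_three _ _ _).trans (add_le_add (add_le_add ?_ ?_) ?_)
  · rw [abs_mul]
    refine mul_le_mul (hcκ k) ?_ (abs_nonneg _)
      (mul_nonneg (mul_nonneg zero_le_two (hw0 k)) hT0)
    refine (Finset.abs_sum_le_sum_abs _ _).trans ?_
    calc ∑ t ∈ lagSet T k, |x' t * y' (t - k) - x t * y (t - k)|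
        ≤ ∑ t ∈ lagSet T k, r * (Z t + Z (t - k)) := Finset.sum_le_sum fun t ht =>
          hxy t (Finset.mem_filter.1 ht).1 _ (Finset.mem_filter.1 ht).2
      _ ≤ r * (2 * ∑ t ∈ Finset.Icc (1 : ℤ) T, Z t) := by
          rw [← Finset.mul_sum]
          exact mul_le_mul_of_nonneg_left (sum_lagSet_add_le hZ T k) hr
  · rw [abs_mul]
    exact mul_le_mul_of_nonneg_right (hcκ k) (abs_nonneg _)
  · rw [abs_mul, abs_mul]
    refine mul_le_of_le_one_right (by positivity) ?_
    rw [abs_of_nonneg (by positivity), ← div_eq_mul_inv]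
    exact div_le_one_of_le₀ (card_lagSet_le T k) (by positivity)

/-- Dominated convergence for the bias, with `a T = |T/(T-p) - 1|` and `e T` a bound for the bandwidth
times the Lipschitz constant of the kernel. -/
theorem tendsto_bias {g : ℤ → ℝ} (hg : Summable g) (hg0 : ∀ k, 0 ≤ g k) {a e : ℕ → ℝ}
    (ha0 : ∀ T, 0 ≤ a T) (ha : Tendsto a atTop (𝓝 0)) (he0 : ∀ T, 0 ≤ e T)
    (he : Tendsto e atTop (𝓝 0)) :
    Tendsto (fun T => ∑' k : ℤ, (a T + min 2 (e T * |(k : ℝ)|)) * g k) atTop (𝓝 0) := by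
  have h := tendsto_tsum_of_dominated_convergence (𝓕 := atTop)
    (f := fun T (k : ℤ) => (a T + min 2 (e T * |(k : ℝ)|)) * g k) (g := fun _ => (0 : ℝ))
    (hg.mul_left 3) (fun k => ?_) ?_
  · simpa using h
  · have h1 : Tendsto (fun T => min 2 (e T * |(k : ℝ)|)) atTop (𝓝 (min 2 (0 * |(k : ℝ)|))) :=
      tendsto_const_nhds.min (he.mul_const _)
    have h2 := (ha.add h1).mul_const (g k)
    simpa using h2
  · filter_upwards [ha.eventually_le_const zero_lt_one] with T hT k
    have h0 : 0 ≤ min 2 (e T * |(k : ℝ)|) := le_min zero_le_two (mul_nonneg (he0 T) (abs_nonneg _))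
    rw [Real.norm_of_nonneg (mul_nonneg (add_nonneg (ha0 T) h0) (hg0 k))]
    refine mul_le_mul_of_nonneg_right ?_ (hg0 k)
    linarith [min_le_left 2 (e T * |(k : ℝ)|)]

theorem tendsto_div_sub_natCast (p : ℕ) :
    Tendsto (fun T : ℕ => (T : ℝ) / ((T : ℝ) - p)) atTop (𝓝 1) := by
  have h : Tendsto (fun T : ℕ => (p : ℝ) / (T : ℝ)) atTop (𝓝 0) :=
    tendsto_const_div_atTop_nhds_zero_nat _
  have h2 : Tendsto (fun T : ℕ => (1 - (p : ℝ) / (T : ℝ))⁻¹) atTop (𝓝 1) := by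
    have := (tendsto_const_nhds (x := (1 : ℝ)) |>.sub h).inv₀ (by norm_num)
    simpa using this
  refine h2.congr' ?_
  filter_upwards [eventually_gt_atTop 0] with T hT
  have : (T : ℝ) ≠ 0 := by positivity
  rw [one_sub_div this, inv_div]

theorem tendsto_natCast_rpow_neg {s : ℝ} (hs : s < 0) (C : ℝ) :
    Tendsto (fun T : ℕ => C * (T : ℝ) ^ s) atTop (𝓝 0) := by
  have := ((tendsto_rpow_neg_atTop (y := -s) (by linarith)).comp
    tendsto_natCast_atTop_atTop).const_mul C
  simpa [Function.comp_def] using this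

/-! ### Bounds with nonrandom weights -/

/-- Pointwise bound for one entry of the estimation error, valid whenever the estimated parameter is
close to the true one and the kernel, evaluated at the selected bandwidth, is dominated by the
weights `w`. -/
theorem enorm_error_le {Ω : Type*} [MeasurableSpace Ω] {P : Measure Ω} {p d : ℕ}
    {Θ : Set (EuclideanSpace ℝ (Fin d))} {β₀ β : EuclideanSpace ℝ (Fin d)}
    {V : ℤ → EuclideanSpace ℝ (Fin d) → Ω → EuclideanSpace ℝ (Fin p)} {K : ℝ → ℝ}
    {ω : Ω} {r₀ r b : ℝ} {T : ℕ} {w B : ℤ → ℝ}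
    (hV : FourthOrderStationary P (trueProcess V β₀)) (hβ₀ : β₀ ∈ Θ) (hβ : β ∈ Θ)
    (hconv : Convex ℝ (Θ ∩ Metric.ball β₀ r₀))
    (hdiff : ∀ t : ℤ, 1 ≤ t → DifferentiableOn ℝ (fun β => V t β ω) Θ)
    (hfin : ∀ t : ℤ, 1 ≤ t → (⨆ β ∈ Θ, ‖fderivWithin ℝ (fun β => V t β ω) Θ β‖ₑ ^ 2) ≠ ∞)
    (hr : ‖β - β₀‖ ≤ r) (hr0 : r < r₀) (hr1 : r ≤ 1)
    (hc : 0 ≤ (T : ℝ) / ((T : ℝ) - p)) (hc2 : (T : ℝ) / ((T : ℝ) - p) ≤ 2)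
    (hw : ∀ k : ℤ, |K (b * k)| ≤ w k)
    (hB : ∀ k : ℤ, |(T : ℝ) / ((T : ℝ) - p) * K (b * k) - 1| ≤ B k) (i j : Fin p) :
    ‖(hacEstimator K (fun t => V t β ω) T b - longRunVar P V β₀ T) i j‖ₑ
      ≤ ENNReal.ofReal (4 * r * (∑ k ∈ Finset.Icc (-(T : ℤ) + 1) ((T : ℤ) - 1), w k) * (T : ℝ)⁻¹)
          * ∑ t ∈ Finset.Icc (1 : ℤ) T,
            ((⨆ β ∈ Θ, ‖fderivWithin ℝ (fun β => V t β ω) Θ β‖ₑ ^ 2) + ‖V t β₀ ω‖ₑ ^ 2)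
        + ∑ k ∈ Finset.Icc (-(T : ℤ) + 1) ((T : ℤ) - 1), ENNReal.ofReal (2 * w k * (T : ℝ)⁻¹) *
          ‖∑ t ∈ lagSet T k, (trueProcess V β₀ t ω i * trueProcess V β₀ (t - k) ω j
            - autocov P (trueProcess V β₀) k i j)‖ₑ
        + ENNReal.ofReal (∑ k ∈ Finset.Icc (-(T : ℤ) + 1) ((T : ℤ) - 1),
            B k * ‖autocov P (trueProcess V β₀) k‖) := by
  set I := Finset.Icc (-(T : ℤ) + 1) ((T : ℤ) - 1)
  set D : ℤ → ℝ≥0∞ := fun t => ⨆ β ∈ Θ, ‖fderivWithin ℝ (fun β => V t β ω) Θ β‖ₑ ^ 2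
  set Z : ℤ → ℝ := fun t => (D t).toReal + ‖V t β₀ ω‖ ^ 2
  have hw0 : ∀ k, 0 ≤ w k := fun k => (abs_nonneg _).trans (hw k)
  have hr' : 0 ≤ r := (norm_nonneg _).trans hr
  have hZ : ∀ t, 0 ≤ Z t := fun t => by positivity
  have hcoord : ∀ (x : EuclideanSpace ℝ (Fin p)) (a : Fin p), |x a| ≤ ‖x‖ := fun x a => by
    simpa using PiLp.norm_apply_le x a
  have hmv : ∀ t ∈ Finset.Icc (1 : ℤ) T, ∀ a, |V t β ω a - V t β₀ ω a| ≤ √(D t).toReal * r := by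
    intro t ht a
    have h1 := (Finset.mem_Icc.1 ht).1
    have h2 := norm_sub_le_sqrt_iSup_fderivWithin hconv (hdiff t h1) (hfin t h1) hβ₀ hβ
      (hr.trans_lt hr0)
    have h3 := hcoord (V t β ω - V t β₀ ω) a
    rw [PiLp.sub_apply] at h3
    exact (h3.trans h2).trans (mul_le_mul_of_nonneg_left hr (Real.sqrt_nonneg _))
  have hsq : ∀ t a, V t β₀ ω a ^ 2 ≤ ‖V t β₀ ω‖ ^ 2 := fun t a => by
    rw [← sq_abs]; exact pow_le_pow_left₀ (abs_nonneg _) (hcoord _ a) 2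
  have hxy : ∀ s ∈ Finset.Icc (1 : ℤ) T, ∀ t ∈ Finset.Icc (1 : ℤ) T,
      |V s β ω i * V t β ω j - trueProcess V β₀ s ω i * trueProcess V β₀ t ω j|
        ≤ r * (Z s + Z t) := fun s hs t ht =>
    abs_mul_sub_mul_le ENNReal.toReal_nonneg ENNReal.toReal_nonneg hr1 (hmv s hs i) (hmv t ht j)
      (hsq s i) (hsq t j) hr'
  have hmain := abs_error_le (κ := fun k => K (b * k))
    (γ := fun k => autocov P (trueProcess V β₀) k i j) (x := fun t => trueProcess V β₀ t ω i)
    (y := fun t => trueProcess V β₀ t ω j) (x' := fun t => V t β ω i) (y' := fun t => V t β ω j)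
    hc hc2 hw hZ hr' hxy I
  have hbias : ∑ k ∈ I, |(T : ℝ) / ((T : ℝ) - p) * K (b * k) - 1|
      * |autocov P (trueProcess V β₀) k i j| ≤ ∑ k ∈ I, B k * ‖autocov P (trueProcess V β₀) k‖ :=
    Finset.sum_le_sum fun k _ => mul_le_mul (hB k) (abs_apply_le_frobenius _ _ _) (abs_nonneg _)
      ((abs_nonneg _).trans (hB k))
  have hZe : ∑ t ∈ Finset.Icc (1 : ℤ) T, (D t + ‖V t β₀ ω‖ₑ ^ 2)
      = ENNReal.ofReal (∑ t ∈ Finset.Icc (1 : ℤ) T, Z t) := by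
    rw [ENNReal.ofReal_sum_of_nonneg fun t _ => hZ t]
    refine Finset.sum_congr rfl fun t ht => ?_
    rw [ENNReal.ofReal_add ENNReal.toReal_nonneg (by positivity),
      ENNReal.ofReal_toReal (hfin t (Finset.mem_Icc.1 ht).1), ENNReal.ofReal_pow (norm_nonneg _),
      ofReal_norm]
  have hSe : ∀ k, ENNReal.ofReal (2 * w k * (T : ℝ)⁻¹) *
      ‖∑ t ∈ lagSet T k, (trueProcess V β₀ t ω i * trueProcess V β₀ (t - k) ω j
            - autocov P (trueProcess V β₀) k i j)‖ₑ
      = ENNReal.ofReal (2 * w k * (T : ℝ)⁻¹ *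
      |∑ t ∈ lagSet T k, (trueProcess V β₀ t ω i * trueProcess V β₀ (t - k) ω j
            - autocov P (trueProcess V β₀) k i j)|) := fun k => by
    have := hw0 k
    rw [ENNReal.ofReal_mul (p := 2 * w k * (T : ℝ)⁻¹) (by positivity), ← Real.norm_eq_abs, ofReal_norm]
  have hWr : 0 ≤ 4 * r * (∑ k ∈ I, w k) * (T : ℝ)⁻¹ := by
    have := Finset.sum_nonneg fun k (_ : k ∈ I) => hw0 k
    positivity
  have hS0 : ∀ k, 0 ≤ 2 * w k * (T : ℝ)⁻¹ *
      |∑ t ∈ lagSet T k, (trueProcess V β₀ t ω i * trueProcess V β₀ (t - k) ω j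
            - autocov P (trueProcess V β₀) k i j)| := fun k => by
    have := hw0 k
    positivity
  rw [hZe, ← ENNReal.ofReal_mul hWr]
  simp only [hSe]
  rw [← ENNReal.ofReal_sum_of_nonneg fun k _ => hS0 k,
    ← ENNReal.ofReal_add (mul_nonneg hWr (Finset.sum_nonneg fun t _ => hZ t))
      (Finset.sum_nonneg fun k _ => hS0 k),
    ← ENNReal.ofReal_add (add_nonneg (mul_nonneg hWr (Finset.sum_nonneg fun t _ => hZ t))
      (Finset.sum_nonneg fun k _ => hS0 k))
      (Finset.sum_nonneg fun k _ => mul_nonneg ((abs_nonneg _).trans (hB k)) (norm_nonneg _)),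
    ← ofReal_norm, Real.norm_eq_abs, Matrix.sub_apply, hacEstimator_apply, longRunVar_apply hV]
  exact ENNReal.ofReal_le_ofReal (hmain.trans (add_le_add le_rfl hbias))

/-- Nonrandom weights that dominate `K (b k)` simultaneously for all bandwidths `b ≥ c T ^ (-δ)`, and
whose sum over the lags is of order `T ^ δ`. -/
theorem KernelClass3.exists_weight {K : ℝ → ℝ} {q : ℝ} (hK : KernelClass3 K q) {c δ : ℝ}
    (hc : 0 < c) (hδ : 0 < δ) :
    ∃ (w : ℕ → ℤ → ℝ) (C : ℝ),
      (∀ T k, 0 ≤ w T k) ∧ (∀ (T : ℕ) (b : ℝ), 0 < T → c * (T : ℝ) ^ (-δ) ≤ b →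
        ∀ k : ℤ, |K (b * k)| ≤ w T k) ∧
      ∀ T : ℕ, 0 < T → ∑ k ∈ Finset.Icc (-(T : ℤ) + 1) ((T : ℤ) - 1), w T k
        ≤ C * (T : ℝ) ^ δ := by
  obtain ⟨A, hA, β, hβ, hmaj⟩ := hK.exists_majorant
  obtain ⟨S, hS, hsum⟩ := exists_sum_weight_le hβ
  refine ⟨fun T k => A * (1 + c * (T : ℝ) ^ (-δ) * |(k : ℝ)|) ^ (-β), A * (1 + S / c),
    fun T k => by positivity, fun T b hT hb k => ?_, fun T hT => ?_⟩
  · -- the majorant is decreasing, so the smallest admissible bandwidth gives the largest value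
    have hb0 : 0 ≤ b := le_trans (by positivity) hb
    refine (hmaj _).trans (mul_le_mul_of_nonneg_left ?_ hA)
    rw [abs_mul, abs_of_nonneg hb0]
    exact Real.rpow_le_rpow_of_nonpos (by positivity) (by gcongr) (by linarith)
  · have hT1 : (1 : ℝ) ≤ T := by exact_mod_cast hT
    have hTδ : 1 ≤ (T : ℝ) ^ δ := Real.one_le_rpow hT1 hδ.le
    rw [← Finset.mul_sum, mul_assoc]
    refine mul_le_mul_of_nonneg_left ((hsum _ (by positivity) T).trans ?_) hA
    rw [Real.rpow_neg (by positivity), div_mul_eq_div_div, div_inv_eq_mul, add_mul, one_mul]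
    gcongr

theorem KernelClass3.exists_bias_le {K : ℝ → ℝ} {q : ℝ} (hK : KernelClass3 K q) :
    ∃ L : ℝ, 0 ≤ L ∧ ∀ (b h c : ℝ) (k : ℤ), 0 ≤ b → b ≤ h →
      |c * K (b * k) - 1| ≤ |c - 1| + min 2 (L * h * |(k : ℝ)|) := by
  obtain ⟨L, hL⟩ := hK.lipschitz
  refine ⟨|L|, abs_nonneg _, fun b h c k hb hbh => ?_⟩
  have h1 : |K (b * k)| ≤ 1 := abs_le.2 (hK.mem_Icc _)
  have h2 : |K (b * k) - 1| ≤ min 2 (|L| * h * |(k : ℝ)|) := by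
    refine le_min ?_ ?_
    · have := abs_le.1 h1
      exact abs_le.2 ⟨by linarith, by linarith⟩
    · have := hL (b * k) 0
      rw [hK.at_zero, sub_zero, abs_mul, abs_of_nonneg hb] at this
      refine this.trans ?_
      rw [mul_assoc]
      gcongr
      exact le_abs_self L
  calc |c * K (b * k) - 1| = |(c - 1) * K (b * k) + (K (b * k) - 1)| := by ring_nf
    _ ≤ |c - 1| * |K (b * k)| + |K (b * k) - 1| := (abs_add_le _ _).trans_eq (by rw [abs_mul])
    _ ≤ |c - 1| * 1 + min 2 (|L| * h * |(k : ℝ)|) := by gcongr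
    _ = _ := by rw [mul_one]

/-- With probability close to one, `αhat` stays in a fixed compact subinterval of `(0, ∞)`. -/
theorem PlugInCondition.exists_bounds {Ω : Type*} [MeasurableSpace Ω] {P : Measure Ω}
    {αhat : ℕ → Ω → ℝ} (hE : PlugInCondition P αhat) {η : ℝ≥0∞} (hη : 0 < η) :
    ∃ m M : ℝ, 0 < m ∧ 0 < M ∧
      ∀ᶠ T in atTop, P {ω | ¬ (m ≤ αhat T ω ∧ αhat T ω ≤ M)} ≤ η := by
  obtain ⟨M₁, h₁⟩ := hE.bounded (η / 2) (ENNReal.half_pos hη.ne')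
  obtain ⟨M₂, h₂⟩ := hE.inv_bounded (η / 2) (ENNReal.half_pos hη.ne')
  have hM₂ : (0 : ℝ) < M₂ + 1 := by positivity
  refine ⟨((M₂ : ℝ) + 1)⁻¹, M₁ + 1, by positivity, by positivity, ?_⟩
  filter_upwards [h₁, h₂] with T h₁ h₂
  refine (measure_mono (t := {ω | (M₁ : ℝ≥0∞) < ‖αhat T ω‖ₑ}
    ∪ {ω | (M₂ : ℝ≥0∞) < (ENNReal.ofReal (αhat T ω))⁻¹}) fun ω hω => ?_).trans
    ((measure_union_le _ _).trans ((add_le_add h₁ h₂).trans_eq (ENNReal.add_halves η)))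
  by_contra hc
  simp only [Set.mem_union, Set.mem_ofPred_eq, not_or, not_lt] at hc
  refine hω ⟨?_, ?_⟩
  · have h3 : ((M₂ + 1 : ℝ≥0) : ℝ≥0∞)⁻¹ ≤ ENNReal.ofReal (αhat T ω) :=
      ENNReal.inv_le_iff_inv_le.1 (hc.2.trans (by simp))
    have h4 : ((M₂ + 1 : ℝ≥0) : ℝ≥0∞)⁻¹ = ENNReal.ofReal ((M₂ : ℝ) + 1)⁻¹ := by
      rw [ENNReal.ofReal_inv_of_pos hM₂]
      congr 1
      rw [← ENNReal.ofReal_coe_nnreal]; simp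
    rw [h4] at h3
    by_contra hlt
    push Not at hlt
    exact absurd h3 (not_le.2 ((ENNReal.ofReal_lt_ofReal_iff (by positivity)).2 hlt))
  · have h3 : ‖αhat T ω‖ ≤ M₁ := by
      have := hc.1
      rw [← ofReal_norm, ← ENNReal.ofReal_coe_nnreal] at this
      exact (ENNReal.ofReal_le_ofReal_iff M₁.2).1 this
    exact (le_abs_self _).trans (h3.trans (by linarith))

theorem BoundedInProb.exists_norm_le {Ω E : Type*} [MeasurableSpace Ω] {P : Measure Ω}
    [NormedAddCommGroup E] [NormedSpace ℝ E] {X : ℕ → Ω → E} {ϑ : ℝ}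
    (h : BoundedInProb P fun T ω => ‖(T : ℝ) ^ ϑ • X T ω‖ₑ) {η : ℝ≥0∞} (hη : 0 < η) :
    ∃ M : ℝ, 0 ≤ M ∧ ∀ᶠ T in atTop, P {ω | ¬ ‖X T ω‖ ≤ M * (T : ℝ) ^ (-ϑ)} ≤ η := by
  obtain ⟨M, hM⟩ := h η hη
  refine ⟨M, M.2, ?_⟩
  filter_upwards [hM, eventually_gt_atTop 0] with T hM hT
  refine (measure_mono fun ω hω => ?_).trans hM
  have hT0 : (0 : ℝ) < (T : ℝ) ^ ϑ := by positivity
  simp only [Set.mem_ofPred_eq, not_le] at hω ⊢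
  rw [← ofReal_norm, ← ENNReal.ofReal_coe_nnreal, norm_smul,
    Real.norm_of_nonneg hT0.le]
  refine (ENNReal.ofReal_lt_ofReal_iff_of_nonneg M.2).2 ?_
  rw [Real.rpow_neg (by positivity), ← div_eq_mul_inv, div_lt_iff₀ hT0, mul_comm ‖_‖] at hω
  exact hω

/-! ### Consistency of the estimator -/

theorem FourthOrderStationary.aemeasurable_enorm {Ω : Type*} [MeasurableSpace Ω] {P : Measure Ω}
    {p d : ℕ} {V : ℤ → EuclideanSpace ℝ (Fin d) → Ω → EuclideanSpace ℝ (Fin p)}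
    {β₀ : EuclideanSpace ℝ (Fin d)} (hV : FourthOrderStationary P (trueProcess V β₀)) (t : ℤ) :
    AEMeasurable (fun ω => ‖V t β₀ ω‖ₑ) P := by
  have h : AEMeasurable (fun ω => V t β₀ ω) P :=
    (WithLp.measurable_toLp 2 (Fin p → ℝ)).comp_aemeasurable
      (aemeasurable_pi_lambda _ fun a => (hV.memLp t a).aestronglyMeasurable.aemeasurable)
  exact h.enorm

/-- The dominating random variables of `enorm_error_le` tend to zero in mean: the first term has
order `T ^ (δ - ϑ)` and the second has order `T ^ (δ - 1/2)`. -/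
theorem tendsto_lintegral_bound {Ω : Type*} [MeasurableSpace Ω] {P : Measure Ω}
    [IsProbabilityMeasure P] {Z : ℤ → Ω → ℝ≥0∞} {S : ℕ → ℤ → Ω → ℝ} {B : ℝ≥0∞}
    {w : ℕ → ℤ → ℝ} {Cw Cs M ϑ δ : ℝ} {b : ℕ → ℝ}
    (hZm : ∀ t : ℤ, 1 ≤ t → AEMeasurable (Z t) P) (hB : B ≠ ∞)
    (hZ : ∀ t : ℤ, 1 ≤ t → ∫⁻ ω, Z t ω ∂P ≤ B)
    (hSm : ∀ T k, AEMeasurable (S T k) P)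
    (hS : ∀ T k, 0 < T → ∫⁻ ω, ‖S T k ω‖ₑ ∂P ≤ ENNReal.ofReal (Cs * √T)) (hCs : 0 ≤ Cs)
    (hw0 : ∀ T k, 0 ≤ w T k)
    (hw : ∀ T : ℕ, 0 < T →
      ∑ k ∈ Finset.Icc (-(T : ℤ) + 1) ((T : ℤ) - 1), w T k ≤ Cw * (T : ℝ) ^ δ)
    (hM : 0 ≤ M) (hδϑ : δ < ϑ) (hδ2 : δ < 1 / 2) (hb : Tendsto b atTop (𝓝 0)) :
    (∀ T : ℕ, AEMeasurable (fun ω => ENNReal.ofReal (4 * (M * (T : ℝ) ^ (-ϑ))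
            * (∑ k ∈ Finset.Icc (-(T : ℤ) + 1) ((T : ℤ) - 1), w T k) * (T : ℝ)⁻¹)
          * ∑ t ∈ Finset.Icc (1 : ℤ) T, Z t ω
        + ∑ k ∈ Finset.Icc (-(T : ℤ) + 1) ((T : ℤ) - 1),
          ENNReal.ofReal (2 * w T k * (T : ℝ)⁻¹) * ‖S T k ω‖ₑ + ENNReal.ofReal (b T)) P) ∧
    Tendsto (fun T : ℕ => ∫⁻ ω, (ENNReal.ofReal (4 * (M * (T : ℝ) ^ (-ϑ))
            * (∑ k ∈ Finset.Icc (-(T : ℤ) + 1) ((T : ℤ) - 1), w T k) * (T : ℝ)⁻¹)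
          * ∑ t ∈ Finset.Icc (1 : ℤ) T, Z t ω
        + ∑ k ∈ Finset.Icc (-(T : ℤ) + 1) ((T : ℤ) - 1),
          ENNReal.ofReal (2 * w T k * (T : ℝ)⁻¹) * ‖S T k ω‖ₑ + ENNReal.ofReal (b T)) ∂P)
      atTop (𝓝 0) := by
  have hZsum : ∀ T : ℕ, AEMeasurable (fun ω => ∑ t ∈ Finset.Icc (1 : ℤ) T, Z t ω) P := fun T =>
    Finset.aemeasurable_fun_sum _ fun t ht => hZm t (Finset.mem_Icc.1 ht).1
  have hSsum : ∀ T : ℕ, AEMeasurable (fun ω =>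
      ∑ k ∈ Finset.Icc (-(T : ℤ) + 1) ((T : ℤ) - 1),
        ENNReal.ofReal (2 * w T k * (T : ℝ)⁻¹) * ‖S T k ω‖ₑ) P := fun T =>
    Finset.aemeasurable_fun_sum _ fun k _ => (hSm T k).enorm.const_mul _
  refine ⟨fun T => (((hZsum T).const_mul _).add (hSsum T)).add aemeasurable_const, ?_⟩
  have hlim : Tendsto (fun T : ℕ => ENNReal.ofReal (4 * M * Cw * (T : ℝ) ^ (δ - ϑ)) * B
      + ENNReal.ofReal (2 * Cw * Cs * (T : ℝ) ^ (δ - 1 / 2)) + ENNReal.ofReal (b T))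
      atTop (𝓝 0) := by
    have h1 := ENNReal.Tendsto.mul_const (b := B) (ENNReal.tendsto_ofReal
      (tendsto_natCast_rpow_neg (sub_neg.2 hδϑ) (4 * M * Cw))) (Or.inr hB)
    have h2 := ENNReal.tendsto_ofReal
      (tendsto_natCast_rpow_neg (sub_neg.2 hδ2) (2 * Cw * Cs))
    simpa using (h1.add h2).add (ENNReal.tendsto_ofReal hb)
  refine tendsto_of_tendsto_of_tendsto_of_le_of_le' tendsto_const_nhds hlim
    (.of_forall fun _ => zero_le) ?_
  filter_upwards [eventually_gt_atTop 0] with T hT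
  have hT0 : (0 : ℝ) < T := by exact_mod_cast hT
  have hW := hw T hT
  set W := ∑ k ∈ Finset.Icc (-(T : ℤ) + 1) ((T : ℤ) - 1), w T k
  rw [lintegral_add_right _ measurable_const, lintegral_add_right' _ (hSsum T),
    lintegral_const_mul'' _ (hZsum T), lintegral_const, measure_univ, mul_one]
  refine add_le_add (add_le_add ?_ ?_) le_rfl
  · rw [lintegral_finsetSum' _ fun t ht => hZm t (Finset.mem_Icc.1 ht).1]
    calc _ ≤ ENNReal.ofReal (4 * (M * (T : ℝ) ^ (-ϑ)) * W * (T : ℝ)⁻¹) * (ENNReal.ofReal T * B) := by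
          gcongr
          refine (Finset.sum_le_sum fun t ht => hZ t (Finset.mem_Icc.1 ht).1).trans ?_
          simp
      _ = ENNReal.ofReal (4 * (M * (T : ℝ) ^ (-ϑ)) * W) * B := by
          rw [← mul_assoc, ← ENNReal.ofReal_mul' hT0.le, inv_mul_cancel_right₀ hT0.ne']
      _ ≤ _ := by
          gcongr ENNReal.ofReal ?_ * B
          calc 4 * (M * (T : ℝ) ^ (-ϑ)) * W ≤ 4 * (M * (T : ℝ) ^ (-ϑ)) * (Cw * (T : ℝ) ^ δ) := by
                gcongr
            _ = _ := by rw [sub_eq_add_neg, Real.rpow_add hT0]; ring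
  · rw [lintegral_finsetSum' _ fun k _ => (hSm T k).enorm.const_mul _]
    calc _ ≤ ∑ k ∈ Finset.Icc (-(T : ℤ) + 1) ((T : ℤ) - 1),
            ENNReal.ofReal (2 * w T k * (T : ℝ)⁻¹ * (Cs * √T)) := by
          refine Finset.sum_le_sum fun k _ => ?_
          have := hw0 T k
          rw [lintegral_const_mul'' _ (hSm T k).enorm,
            ENNReal.ofReal_mul (p := 2 * w T k * (T : ℝ)⁻¹) (by positivity)]
          gcongr
          exact hS T k hT
      _ = ENNReal.ofReal (2 * W * (T : ℝ)⁻¹ * (Cs * √T)) := by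
          rw [← ENNReal.ofReal_sum_of_nonneg fun k _ => by have := hw0 T k; positivity,
            ← Finset.sum_mul, ← Finset.sum_mul, ← Finset.mul_sum]
      _ ≤ _ := by
          refine ENNReal.ofReal_le_ofReal ?_
          calc 2 * W * (T : ℝ)⁻¹ * (Cs * √T)
              ≤ 2 * (Cw * (T : ℝ) ^ δ) * (T : ℝ)⁻¹ * (Cs * √T) := by gcongr
            _ = 2 * Cw * Cs * ((T : ℝ) ^ δ * ((T : ℝ)⁻¹ * √T)) := by ring
            _ = _ := by
                rw [Real.sqrt_eq_rpow, ← Real.rpow_neg_one, ← Real.rpow_add hT0,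
                  ← Real.rpow_add hT0]
                norm_num [sub_eq_add_neg]

end HAC

theorem mainTheorem5 {Ω : Type*} [MeasurableSpace Ω] (P : Measure Ω) [IsProbabilityMeasure P]
    {p d : ℕ}
    (Θ : Set (EuclideanSpace ℝ (Fin d))) (β₀ : EuclideanSpace ℝ (Fin d)) (hβ₀ : β₀ ∈ Θ)
    (hΘ_diff : UniqueDiffOn ℝ Θ)
    (hΘ_convex : ∃ r : ℝ, 0 < r ∧ Convex ℝ (Θ ∩ Metric.ball β₀ r))
    (V : ℤ → EuclideanSpace ℝ (Fin d) → Ω → EuclideanSpace ℝ (Fin p))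
    (βhat : ℕ → Ω → EuclideanSpace ℝ (Fin d)) (hβhat : ∀ T, ∀ᵐ ω ∂P, βhat T ω ∈ Θ)
    (αhat : ℕ → Ω → ℝ) (K : ℝ → ℝ) (q ϑ : ℝ)
    (hϑ : ϑ ∈ Set.Ioo (0 : ℝ) (1 / 2))
    (hK : HAC.KernelClass3 K q)
    (hf : HAC.SpectralDerivFinite P (HAC.trueProcess V β₀) q)
    (hq : (1 / ϑ - 1) / 2 < q)
    (hA : HAC.DependenceCondition P (HAC.trueProcess V β₀))
    (hB : HAC.EstimationCondition P V Θ β₀ βhat ϑ K)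
    (hC : HAC.DerivativeCondition P V Θ β₀)
    (hE : HAC.PlugInCondition P αhat) :
    TendstoInMeasure P
      (fun (T : ℕ) (ω : Ω) =>
        HAC.hacEstimator K (fun t => V t (βhat T ω) ω) T
            (HAC.plugInBandwidth K q (αhat T ω) T)
          - HAC.longRunVar P V β₀ T)
      atTop (fun _ => 0) := by
  have hq0 := hK.q_pos
  obtain ⟨hϑ0, hϑ2⟩ := hϑ
  set δ : ℝ := 1 / (2 * q + 1) with hδ
  have hδ0 : 0 < δ := by positivity
  have hδϑ : δ < ϑ := by
    rw [hδ, one_div_lt (by positivity) hϑ0]; linarith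
  -- the exponent in the definition of the plug-in bandwidth
  have hexp : -1 / (2 * q + 1) = -δ := by rw [hδ, neg_div]
  obtain ⟨r₀, hr₀, hconv⟩ := hΘ_convex
  refine HAC.tendstoInMeasure_matrix fun i j =>
    HAC.tendstoInMeasure_zero_of_dominated fun η hη => ?_
  have hη2 := ENNReal.half_pos hη.ne'
  obtain ⟨m, Mα, hm, hMα, hα⟩ := hE.exists_bounds hη2
  obtain ⟨M, hM, hrate⟩ := hB.rate.exists_norm_le hη2
  obtain ⟨c₁, c₂, hc₁, hc₂, hbw⟩ := hK.plugInBandwidth_bounds hm hMα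
  rw [hexp] at hbw
  obtain ⟨w, Cw, hw0, hw, hwsum⟩ := hK.exists_weight hc₁ hδ0
  obtain ⟨L, hL, hbias⟩ := hK.exists_bias_le
  obtain ⟨Cs, hCs, hS⟩ := hA.exists_lintegral_sum_lagSet_le i j
  have hcT := HAC.tendsto_div_sub_natCast p
  have hh0 : ∀ T : ℕ, 0 ≤ L * (c₂ * (T : ℝ) ^ (-δ)) := fun T => by positivity
  have hbias0 := HAC.tendsto_bias hA.summable_autocov (fun _ => norm_nonneg _)
    (a := fun T : ℕ => |(T : ℝ) / ((T : ℝ) - p) - 1|) (e := fun T : ℕ => L * (c₂ * (T : ℝ) ^ (-δ)))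
    (fun _ => abs_nonneg _) (by simpa using (hcT.sub_const 1).abs) hh0
    (by simpa using (HAC.tendsto_natCast_rpow_neg (neg_neg_of_pos hδ0) c₂).const_mul L)
  have hbsum : ∀ T : ℕ, Summable fun k : ℤ => (|(T : ℝ) / ((T : ℝ) - p) - 1|
      + min 2 (L * (c₂ * (T : ℝ) ^ (-δ)) * |(k : ℝ)|)) * ‖HAC.autocov P (HAC.trueProcess V β₀) k‖ :=
    fun T => Summable.of_nonneg_of_le (fun k => by have := hh0 T; positivity)
      (fun k => mul_le_mul_of_nonneg_right (add_le_add_right (min_le_left _ _) _) (norm_nonneg _))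
      (hA.summable_autocov.mul_left (|(T : ℝ) / ((T : ℝ) - p) - 1| + 2))
  have hdm : ∀ t : ℤ, 1 ≤ t → ∫⁻ ω, ⨆ β ∈ Θ, ‖fderivWithin ℝ (fun β => V t β ω) Θ β‖ₑ ^ 2 ∂P
      ≤ ⨆ (t : ℤ) (_ : 1 ≤ t), ∫⁻ ω, ⨆ β ∈ Θ, ‖fderivWithin ℝ (fun β => V t β ω) Θ β‖ₑ ^ 2 ∂P :=
    fun t ht => le_iSup₂ (f := fun (t : ℤ) (_ : 1 ≤ t) =>
      ∫⁻ ω, ⨆ β ∈ Θ, ‖fderivWithin ℝ (fun β => V t β ω) Θ β‖ₑ ^ 2 ∂P) t ht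
  have hvm : ∀ t : ℤ, 1 ≤ t → ∫⁻ ω, ‖V t β₀ ω‖ₑ ^ 2 ∂P
      ≤ ⨆ (t : ℤ) (_ : 1 ≤ t), ∫⁻ ω, ‖V t β₀ ω‖ₑ ^ 2 ∂P :=
    fun t ht => le_iSup₂ (f := fun (t : ℤ) (_ : 1 ≤ t) => ∫⁻ ω, ‖V t β₀ ω‖ₑ ^ 2 ∂P) t ht
  have hVm : ∀ t, AEMeasurable (fun ω => ‖V t β₀ ω‖ₑ ^ 2) P := fun t =>
    (hA.stationary.aemeasurable_enorm t).pow_const 2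
  have hbound := HAC.tendsto_lintegral_bound (P := P)
    (Z := fun t ω => (⨆ β ∈ Θ, ‖fderivWithin ℝ (fun β => V t β ω) Θ β‖ₑ ^ 2) + ‖V t β₀ ω‖ₑ ^ 2)
    (S := fun T k ω => ∑ t ∈ HAC.lagSet T k, (HAC.trueProcess V β₀ t ω i
      * HAC.trueProcess V β₀ (t - k) ω j - HAC.autocov P (HAC.trueProcess V β₀) k i j))
    (fun t ht => (hB.deriv_measurable t ht).add (hVm t))
    (ENNReal.add_lt_top.2 ⟨hB.deriv_moment, hB.moment⟩).ne
    (fun t ht => (lintegral_add_right' _ (hVm t)).trans_le (add_le_add (hdm t ht) (hvm t ht)))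
    (fun T k => Finset.aemeasurable_fun_sum _ fun t _ =>
      ((hA.stationary.memLp_mul t (t - k) i j).aestronglyMeasurable.aemeasurable.sub_const _))
    hS hCs hw0 hwsum hM hδϑ (hδϑ.trans hϑ2) hbias0
  -- it remains to show that the bound holds outside an event of probability at most `η`
  refine ⟨_, hbound.1, hbound.2, ?_⟩
  have hfin : ∀ᵐ ω ∂P, ∀ t : ℤ, 1 ≤ t →
      (⨆ β ∈ Θ, ‖fderivWithin ℝ (fun β => V t β ω) Θ β‖ₑ ^ 2) ≠ ∞ := by
    rw [ae_all_iff]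
    intro t
    by_cases ht : 1 ≤ t
    · filter_upwards [ae_lt_top' (hB.deriv_measurable t ht)
        ((hdm t ht).trans_lt hB.deriv_moment).ne] with ω hω _ using hω.ne
    · exact .of_forall fun ω h => absurd h ht
  filter_upwards [eventually_gt_atTop 0, hcT.eventually_const_le zero_lt_one,
    hcT.eventually_le_const one_lt_two, hα, hrate,
    (HAC.tendsto_natCast_rpow_neg (neg_neg_of_pos hϑ0) M).eventually_lt_const
      (lt_min hr₀ one_pos)] with T hT hc0 hc2 hαT hrateT hsmall
  have hgood : ∀ᵐ ω ∂P, βhat T ω ∈ Θ ∧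
      (∀ t : ℤ, 1 ≤ t → DifferentiableOn ℝ (fun β => V t β ω) Θ) ∧
      ∀ t : ℤ, 1 ≤ t → (⨆ β ∈ Θ, ‖fderivWithin ℝ (fun β => V t β ω) Θ β‖ₑ ^ 2) ≠ ∞ := by
    filter_upwards [hβhat T, hB.differentiable, hfin] with ω h1 h2 h3 using ⟨h1, h2, h3⟩
  refine (measure_mono_ae (t := {ω | ¬ (m ≤ αhat T ω ∧ αhat T ω ≤ Mα)}
    ∪ {ω | ¬ ‖βhat T ω - β₀‖ ≤ M * (T : ℝ) ^ (-ϑ)}) ?_).trans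
    ((measure_union_le _ _).trans ((add_le_add hαT hrateT).trans_eq (ENNReal.add_halves η)))
  filter_upwards [hgood] with ω ⟨hΘ, hd, hfinω⟩ hω
  by_contra hcon
  obtain ⟨hαω, hrω⟩ : (m ≤ αhat T ω ∧ αhat T ω ≤ Mα) ∧
      ‖βhat T ω - β₀‖ ≤ M * (T : ℝ) ^ (-ϑ) := by
    constructor <;> by_contra hne
    · exact hcon (Or.inl hne)
    · exact hcon (Or.inr hne)
  obtain ⟨hb1, hb2⟩ := hbw T hT _ hαω.1 hαω.2
  have hb0 : 0 ≤ HAC.plugInBandwidth K q (αhat T ω) T := le_trans (by positivity) hb1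
  refine hω ((HAC.enorm_error_le hA.stationary hβ₀ hΘ hconv hd hfinω hrω
    (hsmall.trans_le (min_le_left _ _)) (hsmall.trans_le (min_le_right _ _)).le hc0 hc2
    (hw T _ hT hb1) (fun k => hbias _ _ _ k hb0 hb2) i j).trans ?_)
  refine add_le_add le_rfl (ENNReal.ofReal_le_ofReal ?_)
  exact (hbsum T).sum_le_tsum _ fun k _ => by have := hh0 T; positivity
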